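/- Let $n\ge 1$. Let $\beta,\mu_1,\dots,\mu_{n-1},\nu_1,\dots,\nu_{n-1}$ be the simple roots of type $A_{2n-1}$, let $P$ be the weight lattice, with basis the fundamental weights $\lambda_r$ ($r$ a simple root) and with the pairing $(\alpha_r\mid\lambda_s)=\delta_{rs}$ of simple roots and fundamental weights, and put $\alpha_{i,j}=\mu_1+\dots+\mu_{i-1}+\beta+\nu_1+\dots+\nu_{j-1}$ for $1\le i,j\le n$. For $\wp=(\zeta_1,\dots,\zeta_n,\xi_1,\dots,\xi_n)\in P^{2n}$ put $h^{\wp}_{ij,st}=(\alpha_{s,t}\mid\zeta_i+\xi_j)-(\alpha_{i,j}\mid\zeta_s+\xi_t)$, and let $M_q^\wp(n)$ be the $\mathbb C[q,q^{-1}]$-algebra with generators $\tilde Z_{i,j}$ ($1\le i,j\le n$) and relations $$\tilde Z_{i,j}\tilde Z_{i,k}=q^{h^{\wp}_{ij,ik}+1}\tilde Z_{i,k}\tilde Z_{i,j}\ (j<k),\qquad \tilde Z_{i,j}\tilde Z_{k,j}=q^{h^{\wp}_{ij,kj}+1}\tilde Z_{k,j}\tilde Z_{i,j}\ (i<k),$$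 $$\tilde Z_{i,j}\tilde Z_{s,t}=q^{h^{\wp}_{ij,st}}\tilde Z_{s,t}\tilde Z_{i,j}\ (i<s,\ t<j),$$ $$\tilde Z_{i,j}\tilde Z_{s,t}=q^{h^{\wp}_{ij,st}}\tilde Z_{s,t}\tilde Z_{i,j}+(q-q^{-1})\,q^{(\alpha_{s,t}\mid\zeta_i+\xi_j)-(\alpha_{s,j}\mid\zeta_i+\xi_t)}\tilde Z_{i,t}\tilde Z_{s,j}\ (i<s,\ j<t).$$ Let $\{\cdot,\cdot\}_\wp$ be the Poisson structure on $M(n,\mathbb C)$ given on the coordinate functions by $$\{a_{ij},a_{st}\}_\wp=\bigl(\operatorname{sgn}(s-i)+\operatorname{sgn}(t-j)\bigr)\,a_{it}a_{sj}+h^{\wp}_{ij,st}\,a_{st}a_{ij}.$$ (1) For every odd $m\ge1$, every primitive $m$-th root of unity $\varepsilon$ and every $\wp$, this structure is the semiclassical limit of $M_q^\wp(n)$ at $\varepsilon$: for all $i,j,s,t$ one has $[\tilde Z_{i,j}^m,\tilde Z_{s,t}^m]=m(q^m-1)\,W$ for some $W\in M_q^\wp(n)$ which at $q=\varepsilon$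 specializes to the above expression for $\{a_{ij},a_{st}\}_\wp$ with every $a_{kl}$ replaced by $\tilde Z_{k,l}^m$. For a smooth function $f$ let $\theta_f=\sum_{i,j}\frac{\partial f}{\partial a_{ij}}\theta_{ij}$ with $\theta_{ij}=\sum_{s,t}\{a_{ij},a_{st}\}_\wp\frac{\partial}{\partial a_{st}}$, and let $\mathcal D(a)=\{\theta_f(a)\}$. A symplectic leaf of $\{\cdot,\cdot\}_\wp$ is a maximal (connected, injectively immersed) integral manifold of $\mathcal D$. Let the scaling group $S=(\mathbb C^*)^{2n-1}$ act on $M(n,\mathbb C)$ by $c\cdot(a_{st})=\bigl(\prod_r c_r^{(\alpha_{s,t}\mid\lambda_r)}a_{st}\bigr)$. A symplectic loaf is a set of the form $S(\mathcal L)$ where $\mathcal L$ is a symplectic leaf. (2) The symplectic loaves in $M(n,\mathbb C)$ are the same for all choices of $\wp$: for all $\wp,\wp'\in P^{2n}$, the collection of symplectic loaves of $\{\cdot,\cdot\}_\wp$ equals the collection of symplectic loaves of $\{\cdot,\cdot\}_{\wp'}$. -/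

import Mathlib

open scoped Manifold ContDiff

/-- The simple roots of type `A_{2n-1}`: the noncompact root `β`, the compact roots
`μ_1, …, μ_{n-1}` and the compact roots `ν_1, …, ν_{n-1}` (compact roots are numbered from `0`
here). -/
abbrev SimpleRoot (n : ℕ) : Type := Unit ⊕ Fin (n - 1) ⊕ Fin (n - 1)

/-- The weight lattice `P`: a weight is given by its coordinates with respect to the fundamental
weights `λ_r`, one for every simple root `r`. -/
abbrev Weight (n : ℕ) : Type := SimpleRoot n → ℤ

/-- The root `α_{i,j} = μ_1 + ⋯ + μ_{i-1} + β + ν_1 + ⋯ + ν_{j-1}` (for `i, j` numbered from `1`)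
of the generator `Z_{i,j}`, given by its coordinates with respect to the simple roots. -/
def alphaRoot {n : ℕ} (i j : Fin n) : SimpleRoot n → ℤ
  | Sum.inl _ => 1
  | Sum.inr (Sum.inl k) => if k.val < i.val then 1 else 0
  | Sum.inr (Sum.inr k) => if k.val < j.val then 1 else 0

/-- The pairing `(α | λ)` of a root with a weight, determined by `(α_r | λ_s) = δ_{rs}` for the
simple roots and the fundamental weights. -/
def rootPairing {n : ℕ} (α : SimpleRoot n → ℤ) (l : Weight n) : ℤ := ∑ r, α r * l r

/-- The parameter `℘ = (ζ_1, …, ζ_n, ξ_1, …, ξ_n) ∈ P^{2n}`. -/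
structure Modification (n : ℕ) where
  zeta : Fin n → Weight n
  xi : Fin n → Weight n

/-- The integer `(α_{s,t} | ζ_i + ξ_j) - (α_{i,j} | ζ_s + ξ_t)`. -/
def twistExponent {n : ℕ} (w : Modification n) (i j s t : Fin n) : ℤ :=
  rootPairing (alphaRoot s t) (w.zeta i + w.xi j) -
    rootPairing (alphaRoot i j) (w.zeta s + w.xi t)

section QuantumAlgebra

open LaurentPolynomial

/-- The free generator with index `(i, j)`. -/
noncomputable def freeGen {n : ℕ} (i j : Fin n) : FreeAlgebra ℂ[T;T⁻¹] (Fin n × Fin n) :=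
  FreeAlgebra.ι ℂ[T;T⁻¹] (i, j)

/-- The defining relations of the modified quantum matrix algebra `M_q^℘(n)`, where `q` is the
variable of `ℂ[q, q⁻¹]`; thus `T e` is `q ^ e`. -/
inductive ModifiedRel {n : ℕ} (w : Modification n) :
    FreeAlgebra ℂ[T;T⁻¹] (Fin n × Fin n) → FreeAlgebra ℂ[T;T⁻¹] (Fin n × Fin n) → Prop
  | row (i j k : Fin n) (hjk : j < k) :
      ModifiedRel w (freeGen i j * freeGen i k)
        ((T (twistExponent w i j i k + 1) : ℂ[T;T⁻¹]) • (freeGen i k * freeGen i j))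
  | column (i j k : Fin n) (hik : i < k) :
      ModifiedRel w (freeGen i j * freeGen k j)
        ((T (twistExponent w i j k j + 1) : ℂ[T;T⁻¹]) • (freeGen k j * freeGen i j))
  | antidiagonal (i j s t : Fin n) (his : i < s) (htj : t < j) :
      ModifiedRel w (freeGen i j * freeGen s t)
        ((T (twistExponent w i j s t) : ℂ[T;T⁻¹]) • (freeGen s t * freeGen i j))
  | diagonal (i j s t : Fin n) (his : i < s) (hjt : j < t) :
      ModifiedRel w (freeGen i j * freeGen s t)
        ((T (twistExponent w i j s t) : ℂ[T;T⁻¹]) • (freeGen s t * freeGen i j) +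
          ((T 1 - T (-1)) * T (rootPairing (alphaRoot s t) (w.zeta i + w.xi j) -
              rootPairing (alphaRoot s j) (w.zeta i + w.xi t)) : ℂ[T;T⁻¹]) •
            (freeGen i t * freeGen s j))

/-- The modified quantum matrix algebra `M_q^℘(n)`, as an algebra over `ℂ[q, q⁻¹]`. Its
specialization `M_ε^℘(n)` at a number `ε ≠ 0` is its quotient by the multiples of `q - ε`. -/
abbrev ModifiedAlgebra {n : ℕ} (w : Modification n) : Type := RingQuot (ModifiedRel w)

/-- The generator `Z̃_{i,j}` of `M_q^℘(n)`. -/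
noncomputable def ModifiedAlgebra.gen {n : ℕ} (w : Modification n) (i j : Fin n) :
    ModifiedAlgebra w :=
  RingQuot.mkAlgHom ℂ[T;T⁻¹] (ModifiedRel w) (freeGen i j)

/-- The expression for `{x_{i,j}, x_{s,t}}_℘` in terms of quantities `x_{k,l}` of a ring:
`{x_{i,j}, x_{s,t}}_0` plus `((α_{s,t} | ζ_i + ξ_j) - (α_{i,j} | ζ_s + ξ_t)) x_{s,t} x_{i,j}`,
where `{x_{i,j}, x_{s,t}}_0` is antisymmetric and equals
`x_{i,t} x_{i,j}` if `i = s` and `j < t`, `x_{i,j} x_{s,j}` if `i < s` and `j = t`,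
`0` if `i < s` and `t < j`, and `2 x_{i,t} x_{s,j}` if `i < s` and `j < t`. -/
def bracketExpr {n : ℕ} (w : Modification n) {B : Type*} [Ring B] (x : Fin n → Fin n → B)
    (i j s t : Fin n) : B :=
  (Int.sign ((s.val : ℤ) - i.val) + Int.sign ((t.val : ℤ) - j.val)) •
      (x i t * x s j) +
    twistExponent w i j s t • (x s t * x i j)

/-- The Poisson structure `{·,·}_℘` is the limit for `q → ε` of
`(1 / (m (q^m - 1))) [Z̃_{i,j}^m, Z̃_{s,t}^m]`: this commutator is `m (q^m - 1)` times an element of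
`M_q^℘(n)` whose specialization at `q = ε` is the expression for `{a_{i,j}, a_{s,t}}_℘`
in which each `a_{k,l}` is replaced by `Z̃_{k,l}^m`. -/
def IsSemiclassicalLimit {n : ℕ} (w : Modification n) (m : ℕ) (ε : ℂ) : Prop :=
  ∀ i j s t : Fin n, ∃ W V : ModifiedAlgebra w,
    ModifiedAlgebra.gen w i j ^ m * ModifiedAlgebra.gen w s t ^ m -
        ModifiedAlgebra.gen w s t ^ m * ModifiedAlgebra.gen w i j ^ m =
      ((m : ℂ[T;T⁻¹]) * (T (m : ℤ) - 1)) • W ∧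
    W = bracketExpr w (fun k l => ModifiedAlgebra.gen w k l ^ m) i j s t +
      (T 1 - C ε : ℂ[T;T⁻¹]) • V

end QuantumAlgebra

/-- The space `M(n, ℂ)` of complex `n × n` matrices, as a finite-dimensional normed space. -/
abbrev MatSpace (n : ℕ) : Type := Fin n → Fin n → ℂ

/-- The function `{a_{i,j}, a_{s,t}}_℘` on `M(n, ℂ)`. -/
noncomputable def poissonBracket {n : ℕ} (w : Modification n) (a : MatSpace n) (i j s t : Fin n) : ℂ :=
  bracketExpr w a i j s t

/-- The Hamiltonian vector field `θ_f = ∑_{i,j} (∂f/∂a_{i,j}) θ_{i,j}`, where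
`θ_{i,j} = ∑_{s,t} {a_{i,j}, a_{s,t}}_℘ ∂/∂a_{s,t}`. -/
noncomputable def hamiltonianField {n : ℕ} (w : Modification n) (f : MatSpace n → ℂ)
    (a : MatSpace n) : MatSpace n := fun s t =>
  ∑ i, ∑ j, fderiv ℂ f a (Pi.single i (Pi.single j 1)) * poissonBracket w a i j s t

/-- The distribution `𝒟(a) = {θ_f(a)}` on `M(n, ℂ)`; it consists of complex linear subspaces. -/
def hamiltonianDistribution {n : ℕ} (w : Modification n) (a : MatSpace n) : Set (MatSpace n) :=
  {v | ∃ f : MatSpace n → ℂ, ContDiff ℂ ∞ f ∧ v = hamiltonianField w f a}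

/-- `L` is a (connected) integral manifold of the distribution `D` on `M(n, ℂ)`: it is the image
of a connected smooth manifold `N` under an injective immersion `g` whose tangent space at each
point `p` is `D (g p)`. -/
def IsIntegralManifold {n : ℕ} (D : MatSpace n → Set (MatSpace n)) (L : Set (MatSpace n)) : Prop :=
  ∃ (d : ℕ) (N : Type) (_ : TopologicalSpace N) (_ : ChartedSpace (EuclideanSpace ℝ (Fin d)) N)
    (_ : IsManifold (𝓡 d) ∞ N) (_ : ConnectedSpace N) (g : N → MatSpace n),
    Function.Injective g ∧ Set.range g = L ∧ ContMDiff (𝓡 d) 𝓘(ℝ, MatSpace n) ∞ g ∧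
      ∀ p : N, Function.Injective (mfderiv (𝓡 d) 𝓘(ℝ, MatSpace n) g p) ∧
        ∀ v : MatSpace n, v ∈ D (g p) ↔ ∃ u, mfderiv (𝓡 d) 𝓘(ℝ, MatSpace n) g p u = v

/-- A symplectic leaf of `{·,·}_℘`: a maximal integral manifold of the distribution `𝒟`. -/
def IsSymplecticLeaf {n : ℕ} (w : Modification n) (L : Set (MatSpace n)) : Prop :=
  Maximal (IsIntegralManifold (hamiltonianDistribution w)) L

/-- The action on `M(n, ℂ)` of the element `c = (c_r)` of the scaling group `(ℂ*)^{2n-1}`: the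
product over the simple roots `r` of the maps which multiply each coordinate `a_{s,t}` by
`c_r ^ (α_{s,t} | λ_r)`. -/
def scaleBy {n : ℕ} (c : SimpleRoot n → ℂˣ) (a : MatSpace n) : MatSpace n := fun s t =>
  ((∏ r, c r ^ rootPairing (alphaRoot s t) (Pi.single r 1) : ℂˣ) : ℂ) * a s t

/-- The symplectic loaves of `{·,·}_℘`: the sets `S(L)`, where `L` is a symplectic leaf and `S` is
the scaling group. -/
def symplecticLoaves {n : ℕ} (w : Modification n) : Set (Set (MatSpace n)) :=
  {K | ∃ L, IsSymplecticLeaf w L ∧ K = {b | ∃ c : SimpleRoot n → ℂˣ, ∃ a ∈ L, b = scaleBy c a}}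

/-! ### Orbits of complete flows and plaques of the distribution. -/

section OrbitTheorem

open Set Filter Topology

/-! Loaves. When complete flows preserve the distribution spanned by their generators, its maximal
integral manifolds are the orbits (`FlowFamily.maximal_isIntegralManifold_iff`). This applies to the
Hamiltonian flows of the coordinates `a_{p,q}`: each `a_{p,q}` is constant along its own flow, so
the flow has a closed form (`poissonFlow`), and the Jacobi identity (`bracket_jacobi`) gives
invariance through `fderiv_flow_mem_span`. For fixed `(p,q)` the twist exponent is a function of `s`
plus a function of `t` (`exists_twistExponent_eq`). Changing `℘` therefore multiplies the image of a
point under the flow by factors `exp (x_s + y_t)`, which the scaling group realizes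
(`exists_poissonFlow_eq_scaleBy`). Scalings commute with the flows up to a change of time
(`poissonFlow_scaleBy`), so the orbits of a point for two choices of `℘` have the same saturation
under `S`.

Semiclassical limit. If `x y = q^e y x`, then `x^m y^m = q^(m²e) y^m x^m`, and `(q^(m²e) - 1) / (m
(q^m - 1))` becomes `e` at `ε`. Only the diagonal relation needs more. For a quantum `2 × 2` matrix
with rows `(a, b)` and `(c, d)`, let `x` be the quantum determinant and `y` the rescaled product `b
c`. These commute, and `a^m d^m` and `d^m a^m` are, up to powers of `q`, products of factors `x +
q^k y` over arithmetic progressions of odd `k`, which differ by the shift `2m`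
(`QuantumDet.pow_mul_pow_left`, `QuantumDet.pow_mul_pow_right`). At `q = ε` either product is `x^m +
y^m`, because the odd powers of `ε` run through all `m`-th roots of unity. Expanding the difference
of the two products (`exists_commutingProd_eq`) gives the limit `h (x^m + y^m) + 2 y^m`, which is
the bracket (`QuantumDet.quotCong`). -/

/-- A family of complete smooth flows on a normed space, together with the distribution spanned by
their generating vector fields, assumed invariant under the flows. -/
structure FlowFamily (ι : Type*) (E : Type*) [NormedAddCommGroup E] [NormedSpace ℝ E] where
  flow : ι → ℝ → E → E
  smooth : ∀ k, ContDiff ℝ ∞ (fun p : ℝ × E => flow k p.1 p.2)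
  flow_zero : ∀ k x, flow k 0 x = x
  flow_add : ∀ k s t x, flow k (s + t) x = flow k s (flow k t x)
  dist : E → Submodule ℝ E
  dist_eq : ∀ x, dist x = Submodule.span ℝ (range fun k => deriv (fun t => flow k t x) 0)
  invariant : ∀ k t x, ∀ v ∈ dist x, fderiv ℝ (flow k t) x v ∈ dist (flow k t x)

namespace FlowFamily

variable {ι : Type*} {E : Type*} [NormedAddCommGroup E] [NormedSpace ℝ E] (Φ : FlowFamily ι E)

/-- The vector field generating the `k`-th flow. -/
noncomputable def field (k : ι) (x : E) : E := deriv (fun t => Φ.flow k t x) 0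

/-- The orbit of a point under all the flows. -/
def orbit (a : E) : Set E :=
  {b | Relation.ReflTransGen (fun x y => ∃ k t, y = Φ.flow k t x) a b}

lemma field_mem (k : ι) (x : E) : Φ.field k x ∈ Φ.dist x := by
  rw [Φ.dist_eq]; exact Submodule.subset_span ⟨k, rfl⟩

lemma contDiff_flow_time (k : ι) (x : E) : ContDiff ℝ ∞ fun t => Φ.flow k t x :=
  (Φ.smooth k).comp (contDiff_id.prodMk contDiff_const)

lemma contDiff_flow (k : ι) (t : ℝ) : ContDiff ℝ ∞ (Φ.flow k t) :=
  (Φ.smooth k).comp (contDiff_const.prodMk contDiff_id)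

lemma hasDerivAt_flow (k : ι) (t : ℝ) (x : E) :
    HasDerivAt (fun s => Φ.flow k s x) (Φ.field k (Φ.flow k t x)) t := by
  have h : HasDerivAt (fun s => Φ.flow k s (Φ.flow k t x)) (Φ.field k (Φ.flow k t x)) (t - t) := by
    rw [sub_self]
    exact (((Φ.contDiff_flow_time k _).differentiable (by simp)) 0).hasDerivAt
  refine (h.comp_sub_const t t).congr_of_eventuallyEq (Eventually.of_forall fun s => ?_)
  simp [← Φ.flow_add]

lemma hasFDerivAt_flow (k : ι) (t : ℝ) (x : E) :
    HasFDerivAt (fun p : ℝ × E => Φ.flow k p.1 p.2)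
      ((ContinuousLinearMap.toSpanSingleton ℝ (Φ.field k (Φ.flow k t x))).coprod
        (fderiv ℝ (Φ.flow k t) x)) (t, x) := by
  have h := ((Φ.smooth k).differentiable (by simp) (t, x)).hasFDerivAt
  have e : ((ContinuousLinearMap.toSpanSingleton ℝ (Φ.field k (Φ.flow k t x))).coprod
      (fderiv ℝ (Φ.flow k t) x)) = fderiv ℝ (fun p : ℝ × E => Φ.flow k p.1 p.2) (t, x) := by
    ext v
    · have h1 := h.comp_hasDerivAt t ((hasDerivAt_id t).prodMk (hasDerivAt_const t x))
      simpa using (Φ.hasDerivAt_flow k t x).unique h1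
    · have h1 := h.comp x ((hasFDerivAt_const t x).prodMk (hasFDerivAt_id x))
      have : fderiv ℝ (Φ.flow k t) x = _ := h1.fderiv
      simp [this]
  rw [e]
  exact h

lemma contDiff_field (k : ι) : ContDiff ℝ ∞ (Φ.field k) := by
  have : Φ.field k = fun x => fderiv ℝ (fun p : ℝ × E => Φ.flow k p.1 p.2) (0, x) (1, 0) := by
    ext x; rw [(Φ.hasFDerivAt_flow k 0 x).fderiv]; simp [Φ.flow_zero]
  rw [this]
  exact (((Φ.smooth k).fderiv_right (m := ∞) (by simp)).comp
    (contDiff_const.prodMk contDiff_id)).clm_apply contDiff_const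

lemma flow_neg_flow (k : ι) (t : ℝ) (x : E) : Φ.flow k (-t) (Φ.flow k t x) = x := by
  rw [← Φ.flow_add, neg_add_cancel, Φ.flow_zero]

/-- The derivative of a flow map is injective, with left inverse the derivative of the reversed
flow, so invariance gives one inequality; the same inequality for time `-t` is the other. -/
lemma finrank_dist_flow [FiniteDimensional ℝ E] (k : ι) (t : ℝ) (x : E) :
    Module.finrank ℝ (Φ.dist (Φ.flow k t x)) = Module.finrank ℝ (Φ.dist x) := by
  have key : ∀ t x, Module.finrank ℝ (Φ.dist x) ≤ Module.finrank ℝ (Φ.dist (Φ.flow k t x)) := by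
    intro t x
    have hcomp : (fderiv ℝ (Φ.flow k (-t)) (Φ.flow k t x)).comp (fderiv ℝ (Φ.flow k t) x) =
        ContinuousLinearMap.id ℝ E := by
      rw [← fderiv_comp]
      · have : Φ.flow k (-t) ∘ Φ.flow k t = id := funext fun y => Φ.flow_neg_flow k t y
        rw [this, fderiv_id]
      · exact (Φ.contDiff_flow k _).differentiable (by simp) _
      · exact (Φ.contDiff_flow k _).differentiable (by simp) _
    refine LinearMap.finrank_le_finrank_of_injective
      (f := (fderiv ℝ (Φ.flow k t) x).toLinearMap.restrict (Φ.invariant k t x)) ?_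
    intro u v huv
    have h1 : fderiv ℝ (Φ.flow k t) x u = fderiv ℝ (Φ.flow k t) x v := congrArg Subtype.val huv
    have h2 := fun w => congrArg (fun L => L w) hcomp
    simp only [ContinuousLinearMap.comp_apply, ContinuousLinearMap.id_apply] at h2
    exact Subtype.ext (by rw [← h2 u, ← h2 v, h1])
  refine le_antisymm ?_ (key t x)
  have := key (-t) (Φ.flow k t x)
  rwa [Φ.flow_neg_flow] at this

lemma mem_orbit_self (a : E) : a ∈ Φ.orbit a := Relation.ReflTransGen.refl

lemma flow_mem_orbit {a b : E} (hb : b ∈ Φ.orbit a) (k : ι) (t : ℝ) : Φ.flow k t b ∈ Φ.orbit a :=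
  Relation.ReflTransGen.tail hb ⟨k, t, rfl⟩

lemma orbit_symm {a b : E} (hb : b ∈ Φ.orbit a) : a ∈ Φ.orbit b :=
  have : Std.Symm fun x y => ∃ k t, y = Φ.flow k t x :=
    ⟨fun x y ⟨k, t, h⟩ => ⟨k, -t, by rw [h, Φ.flow_neg_flow]⟩⟩
  Relation.ReflTransGen.stdSymm.symm _ _ hb

lemma orbit_subset {a b : E} (hb : b ∈ Φ.orbit a) : Φ.orbit b ⊆ Φ.orbit a :=
  fun _ hc => Relation.ReflTransGen.trans hb hc

lemma orbit_eq {a b : E} (hb : b ∈ Φ.orbit a) : Φ.orbit b = Φ.orbit a :=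
  (Φ.orbit_subset hb).antisymm (Φ.orbit_subset (Φ.orbit_symm hb))

lemma finrank_dist_orbit [FiniteDimensional ℝ E] {a b : E} (hb : b ∈ Φ.orbit a) :
    Module.finrank ℝ (Φ.dist b) = Module.finrank ℝ (Φ.dist a) := by
  induction hb with
  | refl => rfl
  | tail _ h ih => obtain ⟨k, t, rfl⟩ := h; rw [Φ.finrank_dist_flow, ih]

/-- The composition of the flows `k i`, for `i` in a list, with times `t i`, applied to `a`. -/
def flowList {d : ℕ} (k : Fin d → ι) (a : E) :
    List (Fin d) → EuclideanSpace ℝ (Fin d) → E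
  | [], _ => a
  | i :: l, t => Φ.flow (k i) (t i) (flowList k a l t)

lemma flowList_mem {d : ℕ} (k : Fin d → ι) (a : E) (l : List (Fin d))
    (t : EuclideanSpace ℝ (Fin d)) : Φ.flowList k a l t ∈ Φ.orbit a := by
  induction l with
  | nil => exact Φ.mem_orbit_self a
  | cons i l ih => exact Φ.flow_mem_orbit ih _ _

lemma contDiff_flowList {d : ℕ} (k : Fin d → ι) (a : E) (l : List (Fin d)) :
    ContDiff ℝ ∞ (Φ.flowList k a l) := by
  induction l with
  | nil => exact contDiff_const
  | cons i l ih =>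
    have h1 : ContDiff ℝ ∞ fun t : EuclideanSpace ℝ (Fin d) => t i :=
      (EuclideanSpace.proj (𝕜 := ℝ) i).contDiff
    exact (Φ.smooth (k i)).comp (h1.prodMk ih)

lemma flowList_zero {d : ℕ} (k : Fin d → ι) (a : E) (l : List (Fin d)) :
    Φ.flowList k a l 0 = a := by
  induction l with
  | nil => rfl
  | cons i l ih => simp [flowList, ih, Φ.flow_zero]

lemma fderiv_flowList_cons {d : ℕ} (k : Fin d → ι) (a : E) (i : Fin d) (l : List (Fin d))
    (t v : EuclideanSpace ℝ (Fin d)) :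
    fderiv ℝ (Φ.flowList k a (i :: l)) t v =
      v i • Φ.field (k i) (Φ.flowList k a (i :: l) t) +
      fderiv ℝ (Φ.flow (k i) (t i)) (Φ.flowList k a l t) (fderiv ℝ (Φ.flowList k a l) t v) := by
  have h1 : HasFDerivAt (fun t : EuclideanSpace ℝ (Fin d) => t i)
      (EuclideanSpace.proj (𝕜 := ℝ) i) t := (EuclideanSpace.proj (𝕜 := ℝ) i).hasFDerivAt
  have h2 := ((Φ.contDiff_flowList k a l).differentiable (by simp) t).hasFDerivAt
  have h3 := (Φ.hasFDerivAt_flow (k i) (t i) (Φ.flowList k a l t)).comp t (h1.prodMk h2)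
  have h4 : fderiv ℝ (Φ.flowList k a (i :: l)) t = _ := h3.fderiv
  rw [h4]
  simp [flowList]

/-- The outermost time contributes a generating field, and the inner times contribute a vector of
the distribution pushed forward by a flow; invariance keeps the latter in the distribution. -/
lemma fderiv_flowList_mem {d : ℕ} (k : Fin d → ι) (a : E) (l : List (Fin d))
    (t v : EuclideanSpace ℝ (Fin d)) :
    fderiv ℝ (Φ.flowList k a l) t v ∈ Φ.dist (Φ.flowList k a l t) := by
  induction l with
  | nil =>
    have : Φ.flowList k a [] = fun _ => a := rfl
    simp [this]
  | cons i l ih =>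
    rw [fderiv_flowList_cons]
    exact add_mem (Submodule.smul_mem _ _ (Φ.field_mem _ _)) (Φ.invariant _ _ _ _ ih)

/-- At time zero every flow map is the identity. Independent fields at `a` thus make the composed
flow an immersion at `0`. -/
lemma fderiv_flowList_zero {d : ℕ} (k : Fin d → ι) (a : E) (l : List (Fin d))
    (v : EuclideanSpace ℝ (Fin d)) :
    fderiv ℝ (Φ.flowList k a l) 0 v = (l.map fun i => v i • Φ.field (k i) a).sum := by
  induction l with
  | nil =>
    have : Φ.flowList k a [] = fun _ => a := rfl
    simp [this]
  | cons i l ih =>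
    have h : Φ.flow (k i) 0 = id := funext fun x => Φ.flow_zero _ x
    rw [fderiv_flowList_cons, ih, flowList_zero]
    simp [h]

end FlowFamily

/-- A plaque through `a` of a distribution `D`: a section `sect` of a linear projection `proj` over
an open set `dom`, with values in `O` and tangent to `D`. At the points of `nhd` where `D` has
dimension `d`, it is contained in the graph of `frame`. -/
structure Plaque {E : Type*} [NormedAddCommGroup E] [NormedSpace ℝ E] (D : E → Submodule ℝ E)
    (O : Set E) (d : ℕ) (a : E) where
  proj : E →L[ℝ] EuclideanSpace ℝ (Fin d)
  sect : EuclideanSpace ℝ (Fin d) → E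
  dom : Set (EuclideanSpace ℝ (Fin d))
  nhd : Set E
  frame : E → EuclideanSpace ℝ (Fin d) →L[ℝ] E
  isOpen_dom : IsOpen dom
  isOpen_nhd : IsOpen nhd
  proj_mem : proj a ∈ dom
  sect_proj : sect (proj a) = a
  contDiffAt_sect : ∀ u ∈ dom, ContDiffAt ℝ ∞ sect u
  proj_sect : ∀ u ∈ dom, proj (sect u) = u
  sect_mem : ∀ u ∈ dom, sect u ∈ O
  sect_mem_nhd : ∀ u ∈ dom, sect u ∈ nhd
  range_fderiv : ∀ u ∈ dom, (fderiv ℝ sect u).range = D (sect u)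
  contDiffAt_frame : ∀ z ∈ nhd, ContDiffAt ℝ 1 frame z
  eq_frame : ∀ z ∈ nhd, Module.finrank ℝ (D z) = d → ∀ v ∈ D z, v = frame z (proj v)

namespace Plaque

variable {E : Type*} [NormedAddCommGroup E] [NormedSpace ℝ E] {D : E → Submodule ℝ E}
  {O : Set E} {d : ℕ} {a : E} (P : Plaque D O d a)

/-- The points of the plaque. -/
def carrier : Set E := {z | P.proj z ∈ P.dom ∧ P.sect (P.proj z) = z}

lemma self_mem : a ∈ P.carrier := ⟨P.proj_mem, P.sect_proj⟩

lemma carrier_subset : P.carrier ⊆ O := fun _ hz => hz.2 ▸ P.sect_mem _ hz.1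

lemma proj_fderiv {u : EuclideanSpace ℝ (Fin d)} (hu : u ∈ P.dom) (v : EuclideanSpace ℝ (Fin d)) :
    P.proj (fderiv ℝ P.sect u v) = v := by
  have h1 : HasFDerivAt (fun u => P.proj (P.sect u)) (P.proj.comp (fderiv ℝ P.sect u)) u :=
    P.proj.hasFDerivAt.comp u
      ((P.contDiffAt_sect u hu).differentiableAt (by simp)).hasFDerivAt
  have h2 : HasFDerivAt (fun u => P.proj (P.sect u)) (ContinuousLinearMap.id ℝ _) u :=
    (hasFDerivAt_id u).congr_of_eventuallyEq
      (by filter_upwards [P.isOpen_dom.mem_nhds hu] with w hw using P.proj_sect w hw)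
  exact congrArg (fun L => L v) (h1.unique h2)

lemma injective_fderiv {u : EuclideanSpace ℝ (Fin d)} (hu : u ∈ P.dom) :
    Function.Injective (fderiv ℝ P.sect u) :=
  Function.LeftInverse.injective (g := P.proj) (P.proj_fderiv hu)

lemma finrank_dist {u : EuclideanSpace ℝ (Fin d)} (hu : u ∈ P.dom) :
    Module.finrank ℝ (D (P.sect u)) = d := by
  rw [← P.range_fderiv u hu]
  exact (LinearMap.finrank_range_of_inj (P.injective_fderiv hu)).trans (by simp)

/-- The section solves a total differential equation with `C^1` right-hand side; uniqueness for it
is what keeps tangent maps inside a plaque. -/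
lemma fderiv_eq_frame {u : EuclideanSpace ℝ (Fin d)} (hu : u ∈ P.dom)
    (v : EuclideanSpace ℝ (Fin d)) : fderiv ℝ P.sect u v = P.frame (P.sect u) v := by
  have h := P.eq_frame _ (P.sect_mem_nhd u hu) (P.finrank_dist hu) (fderiv ℝ P.sect u v)
    (by rw [← P.range_fderiv u hu]; exact ⟨v, rfl⟩)
  rwa [P.proj_fderiv hu] at h

/-- A map tangent to the distribution which meets a plaque remains in it locally. -/
theorem eventually_mem_carrier {G : Type*} [NormedAddCommGroup G] [NormedSpace ℝ G] {g : G → E}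
    {p : G} (hg : ContDiffAt ℝ 1 g p) (hp : g p ∈ P.carrier)
    (hD : ∀ᶠ x in 𝓝 p, (∀ v, fderiv ℝ g x v ∈ D (g x)) ∧ Module.finrank ℝ (D (g x)) = d) :
    ∀ᶠ x in 𝓝 p, g x ∈ P.carrier := by
  obtain ⟨hp1, hp2⟩ := hp
  have hz : g p ∈ P.nhd := hp2 ▸ P.sect_mem_nhd _ hp1
  obtain ⟨C, t, ht, hC⟩ := (P.contDiffAt_frame _ hz).exists_lipschitzOnWith
  have hgc := hg.continuousAt
  have hpgc : ContinuousAt (fun x => P.proj (g x)) p := P.proj.continuous.continuousAt.comp hgc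
  have hsc : ContinuousAt (fun x => P.sect (P.proj (g x))) p :=
    ContinuousAt.comp (f := fun x => P.proj (g x)) (P.contDiffAt_sect _ hp1).continuousAt hpgc
  have hdc : ContinuousAt (fderiv ℝ g) p :=
    (hg.fderiv_right (m := 0) (by simp)).continuousAt
  have hbd : ∀ᶠ x in 𝓝 p, ‖fderiv ℝ g x‖ < ‖fderiv ℝ g p‖ + 1 :=
    hdc.norm.eventually_lt continuousAt_const (by simp)
  have hall := hD.and ((hgc.eventually ht).and ((hsc.eventually (hp2.symm ▸ ht)).and
    ((hgc.eventually (P.isOpen_nhd.mem_nhds hz)).and ((hpgc.eventually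
      (P.isOpen_dom.mem_nhds hp1)).and (hbd.and (hg.eventually (by simp)))))))
  obtain ⟨r, hr, hball⟩ := Metric.eventually_nhds_iff_ball.1 hall
  filter_upwards [Metric.ball_mem_nhds p hr] with x hx
  set w := x - p with hw
  have hseg : ∀ s ∈ Icc (0 : ℝ) 1, p + s • w ∈ Metric.ball p r := by
    intro s hs
    have hx' : ‖w‖ < r := by simpa [hw, dist_eq_norm] using hx
    simp only [Metric.mem_ball, dist_eq_norm, add_sub_cancel_left, norm_smul, Real.norm_eq_abs,
      abs_of_nonneg hs.1]
    nlinarith [hs.2, norm_nonneg w]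
  -- `η` measures the distance of `g` from the graph of the section along the segment from `p` to
  -- `x`. It vanishes at `s = 0`, and the Lipschitz bound on the frame gives `‖η'‖ ≤ K ‖η‖`, so
  -- Grönwall's inequality makes it zero.
  let η : ℝ → E := fun s => g (p + s • w) - P.sect (P.proj (g (p + s • w)))
  let η' : ℝ → E := fun s => fderiv ℝ g (p + s • w) w -
    fderiv ℝ P.sect (P.proj (g (p + s • w))) (P.proj (fderiv ℝ g (p + s • w) w))
  have hη : ∀ s ∈ Icc (0 : ℝ) 1, HasDerivAt η (η' s) s := by
    intro s hs
    obtain ⟨_, _, _, _, h5, _, h7⟩ := hball _ (hseg s hs)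
    have l1 : HasDerivAt (fun s : ℝ => p + s • w) w s := by
      simpa using ((hasDerivAt_id s).smul_const w).const_add p
    have l2 : HasDerivAt (fun s : ℝ => g (p + s • w)) (fderiv ℝ g (p + s • w) w) s :=
      (h7.differentiableAt (by simp)).hasFDerivAt.comp_hasDerivAt s l1
    have l3 : HasDerivAt (fun s : ℝ => P.proj (g (p + s • w)))
        (P.proj (fderiv ℝ g (p + s • w) w)) s := P.proj.hasFDerivAt.comp_hasDerivAt s l2
    have l4 := (((P.contDiffAt_sect _ h5).differentiableAt
      (by simp)).hasFDerivAt).comp_hasDerivAt s l3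
    exact l2.sub l4
  have hbound : ∀ s ∈ Icc (0 : ℝ) 1,
      ‖η' s‖ ≤ (C * (‖P.proj‖ * ((‖fderiv ℝ g p‖ + 1) * ‖w‖))) * ‖η s‖ := by
    intro s hs
    obtain ⟨⟨h1, h1'⟩, h2, h3, h4, h5, h6, h7⟩ := hball _ (hseg s hs)
    -- Both `g` and the section have derivatives given by the frame, applied to the same projected
    -- velocity.
    have e1 : η' s = (P.frame (g (p + s • w)) - P.frame (P.sect (P.proj (g (p + s • w)))))
        (P.proj (fderiv ℝ g (p + s • w) w)) := by
      have := P.eq_frame _ h4 h1' _ (h1 w)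
      simp only [η', sub_apply]
      rw [P.fderiv_eq_frame h5, ← this]
    rw [e1]
    have n1 : ‖P.frame (g (p + s • w)) - P.frame (P.sect (P.proj (g (p + s • w))))‖ ≤
        C * ‖η s‖ := hC.norm_sub_le h2 h3
    have n2 : ‖P.proj (fderiv ℝ g (p + s • w) w)‖ ≤
        ‖P.proj‖ * ((‖fderiv ℝ g p‖ + 1) * ‖w‖) := by
      refine (P.proj.le_opNorm _).trans ?_
      gcongr
      refine (ContinuousLinearMap.le_opNorm _ _).trans ?_
      gcongr
    refine (ContinuousLinearMap.le_opNorm _ _).trans ?_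
    calc _ ≤ (C * ‖η s‖) * (‖P.proj‖ * ((‖fderiv ℝ g p‖ + 1) * ‖w‖)) := by gcongr
      _ = _ := by ring
  have hzero := eq_zero_of_abs_deriv_le_mul_abs_self_of_eq_zero_right (f := η) (f' := η')
    (a := 0) (b := 1) (fun s hs => (hη s hs).continuousAt.continuousWithinAt)
    (fun s hs => (hη s (Ico_subset_Icc_self hs)).hasDerivWithinAt)
    (by simp [η, hp2]) (fun s hs => hbound s (Ico_subset_Icc_self hs)) 1 (by simp)
  have hx1 : p + (1 : ℝ) • w = x := by simp [hw]
  have h5 := (hball _ (hseg 1 (by simp))).2.2.2.2.1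
  simp only [η, hx1] at hzero h5
  exact ⟨h5, (sub_eq_zero.1 hzero).symm⟩

end Plaque

end OrbitTheorem

/-! ### Plaques through every point and the leaf manifold they define. -/

section OrbitManifold

open Set Filter Topology

/-- Compose `d` flows whose fields form a basis of the distribution at `a`. The resulting map `F`
stays in the orbit and is tangent to the distribution, and `π ∘ F` is a local diffeomorphism at `0`
for a suitable projection `π`; the section is `F ∘ (π ∘ F)⁻¹`. Its tangent spaces fill the
distribution because the dimension is constant on the orbit. -/
theorem FlowFamily.exists_plaque {ι : Type*} {E : Type*} [NormedAddCommGroup E] [NormedSpace ℝ E]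
    [FiniteDimensional ℝ E] (Φ : FlowFamily ι E) (a : E) :
    Nonempty (Plaque Φ.dist (Φ.orbit a) (Module.finrank ℝ (Φ.dist a)) a) := by
  set d := Module.finrank ℝ (Φ.dist a) with hd
  obtain ⟨k, hk⟩ : ∃ k : Fin d → ι, LinearIndependent ℝ fun i => Φ.field (k i) a := by
    obtain ⟨f, hf, -, hli⟩ := Submodule.exists_fun_fin_finrank_span_eq ℝ
      (range fun k => deriv (fun t => Φ.flow k t a) 0)
    rw [hd, Φ.dist_eq]
    choose k hk using hf
    rw [← funext hk] at hli
    exact ⟨k, hli⟩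
  let K : E → EuclideanSpace ℝ (Fin d) →L[ℝ] E := fun z =>
    ∑ i, (EuclideanSpace.proj (𝕜 := ℝ) i : EuclideanSpace ℝ (Fin d) →L[ℝ] ℝ).smulRight
      (Φ.field (k i) z)
  have hKapp : ∀ z u, K z u = ∑ i, u i • Φ.field (k i) z := by
    intro z u
    simp [K]
  have hKs : ContDiff ℝ ∞ K := by
    refine ContDiff.sum fun i _ => ?_
    exact contDiff_const.smulRight (Φ.contDiff_field (k i))
  have hKD : ∀ z u, K z u ∈ Φ.dist z := fun z u => by
    rw [hKapp]
    exact Submodule.sum_mem _ fun i _ => Submodule.smul_mem _ _ (Φ.field_mem _ _)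
  have hKinj : Function.Injective (K a).toLinearMap := by
    rw [← LinearMap.ker_eq_bot, LinearMap.ker_eq_bot']
    intro u hu
    have h := Fintype.linearIndependent_iff.1 hk (fun i => u i) (by rw [← hKapp]; exact hu)
    ext i; exact h i
  obtain ⟨π₀, hπ₀⟩ := LinearMap.exists_leftInverse_of_injective (K a).toLinearMap
    (LinearMap.ker_eq_bot.2 hKinj)
  let π : E →L[ℝ] EuclideanSpace ℝ (Fin d) := LinearMap.toContinuousLinearMap π₀
  have hπ : π.comp (K a) = ContinuousLinearMap.id ℝ _ := by
    ext u : 1; exact congrArg (fun L => L u) hπ₀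
  let eqv : Set (EuclideanSpace ℝ (Fin d) →L[ℝ] EuclideanSpace ℝ (Fin d)) :=
    range ((↑) : (EuclideanSpace ℝ (Fin d) ≃L[ℝ] EuclideanSpace ℝ (Fin d)) → _)
  have heqv : IsOpen eqv := ContinuousLinearEquiv.isOpen
  have hid : ContinuousLinearMap.id ℝ (EuclideanSpace ℝ (Fin d)) ∈ eqv :=
    ⟨ContinuousLinearEquiv.refl ℝ _, rfl⟩
  -- On this open set `π` is injective on the span of the chosen fields, so a vector `v` of that
  -- span is recovered as `K z ((π K z)⁻¹ (π v))`; this is the frame.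
  let W : Set E := {z | π.comp (K z) ∈ eqv}
  have hMs : ContDiff ℝ ∞ fun z => π.comp (K z) := contDiff_const.clm_comp hKs
  have hW : IsOpen W := heqv.preimage hMs.continuous
  let F := Φ.flowList k a (List.finRange d)
  have hF : ContDiff ℝ ∞ F := Φ.contDiff_flowList k a _
  have hF0 : F 0 = a := Φ.flowList_zero k a _
  let G : EuclideanSpace ℝ (Fin d) → EuclideanSpace ℝ (Fin d) := fun t => π (F t)
  have hG : ContDiff ℝ ∞ G := π.contDiff.comp hF
  have hG0 : fderiv ℝ G 0 = ContinuousLinearMap.id ℝ _ := by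
    have h1 : fderiv ℝ F 0 = K a := by
      ext1 v
      rw [hKapp, Φ.fderiv_flowList_zero, ← List.ofFn_eq_map, List.sum_ofFn]
    have h2 : HasFDerivAt G (π.comp (fderiv ℝ F 0)) 0 :=
      π.hasFDerivAt.comp 0 (hF.differentiable (by simp) 0).hasFDerivAt
    rw [h2.fderiv, h1, hπ]
  have hG0' : HasFDerivAt G ((ContinuousLinearEquiv.refl ℝ (EuclideanSpace ℝ (Fin d)) :
      EuclideanSpace ℝ (Fin d) ≃L[ℝ] EuclideanSpace ℝ (Fin d)) :
      EuclideanSpace ℝ (Fin d) →L[ℝ] EuclideanSpace ℝ (Fin d)) 0 := by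
    have := (hG.differentiable (by simp) 0).hasFDerivAt
    rw [hG0] at this
    exact this
  let T := hG.contDiffAt.toOpenPartialHomeomorph G hG0' (by simp)
  have hTG : ∀ t, T t = G t := fun t => rfl
  have hT0 : (0 : EuclideanSpace ℝ (Fin d)) ∈ T.source :=
    hG.contDiffAt.mem_toOpenPartialHomeomorph_source hG0' (by simp)
  have hG0a : G 0 = π a := by simp only [G, hF0]
  have hTa : T.symm (π a) = 0 := by rw [← hG0a, ← hTG, T.left_inv hT0]
  let V : Set (EuclideanSpace ℝ (Fin d)) := F ⁻¹' W ∩ {t | fderiv ℝ G t ∈ eqv}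
  have hV : IsOpen V := (hW.preimage hF.continuous).inter
    (heqv.preimage (hG.continuous_fderiv (by simp)))
  have hsect : ∀ u ∈ T.target ∩ T.symm ⁻¹' V, ContDiffAt ℝ ∞ (fun u => F (T.symm u)) u := by
    rintro u ⟨hu, -, e, he⟩
    refine hF.contDiffAt.comp u (T.contDiffAt_symm (f₀' := e) hu ?_ hG.contDiffAt)
    rw [he]
    exact (hG.differentiable (by simp) _).hasFDerivAt
  have hps : ∀ u ∈ T.target ∩ T.symm ⁻¹' V, π (F (T.symm u)) = u := fun u hu => T.right_inv hu.1
  have hopen : IsOpen (T.target ∩ T.symm ⁻¹' V) := T.isOpen_inter_preimage_symm hV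
  refine ⟨{ proj := π, sect := fun u => F (T.symm u), dom := T.target ∩ T.symm ⁻¹' V, nhd := W
            frame := fun z => (K z).comp (π.comp (K z)).inverse
            isOpen_dom := hopen
            isOpen_nhd := hW
            proj_mem := ?_
            sect_proj := by rw [hTa, hF0]
            contDiffAt_sect := hsect
            proj_sect := hps
            sect_mem := fun u _ => Φ.flowList_mem k a _ _
            sect_mem_nhd := fun u hu => hu.2.1
            range_fderiv := ?_
            contDiffAt_frame := ?_
            eq_frame := ?_ }⟩
  · refine ⟨?_, ?_⟩
    · rw [← hG0a, ← hTG]; exact T.map_source hT0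
    · rw [mem_preimage, hTa]
      refine ⟨?_, ?_⟩
      · rw [mem_preimage, hF0]
        exact (congrArg (· ∈ eqv) hπ).mpr hid
      · exact (congrArg (· ∈ eqv) hG0).mpr hid
  · intro u hu
    have hdiff := ((hsect u hu).differentiableAt (by simp)).hasFDerivAt
    have hle : (fderiv ℝ (fun u => F (T.symm u)) u).range ≤ Φ.dist (F (T.symm u)) := by
      obtain ⟨e, he⟩ := hu.2.2
      have hTs : DifferentiableAt ℝ T.symm u := by
        refine ContDiffAt.differentiableAt (n := 1) (T.contDiffAt_symm (f₀' := e) hu.1 ?_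
          (hG.contDiffAt.of_le (by simp))) (by simp)
        rw [he]
        exact (hG.differentiable (by simp) _).hasFDerivAt
      have hc : HasFDerivAt (fun u => F (T.symm u))
          ((fderiv ℝ F (T.symm u)).comp (fderiv ℝ T.symm u)) u :=
        (hF.differentiable (by simp) (T.symm u)).hasFDerivAt.comp u hTs.hasFDerivAt
      rw [hc.fderiv]
      rintro _ ⟨v, rfl⟩
      exact Φ.fderiv_flowList_mem k a _ _ _
    refine Submodule.eq_of_le_of_finrank_eq hle ?_
    have hinj : Function.Injective (fderiv ℝ (fun u => F (T.symm u)) u) := by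
      have h1 : HasFDerivAt (fun u => π (F (T.symm u))) (π.comp _) u :=
        π.hasFDerivAt.comp u hdiff
      have h2 : HasFDerivAt (fun u => π (F (T.symm u))) (ContinuousLinearMap.id ℝ _) u :=
        (hasFDerivAt_id u).congr_of_eventuallyEq
          (by filter_upwards [hopen.mem_nhds hu] with w hw using hps w hw)
      exact Function.LeftInverse.injective (g := π)
        (fun v => congrArg (fun L => L v) (h1.unique h2))
    rw [Φ.finrank_dist_orbit (Φ.flowList_mem k a _ _)]
    exact (LinearMap.finrank_range_of_inj hinj).trans (by simp [hd])
  · rintro z ⟨e, he⟩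
    have h1 : ContDiffAt ℝ 1 ContinuousLinearMap.inverse (π.comp (K z)) := by
      rw [← he]; exact contDiffAt_map_inverse e
    exact (hKs.contDiffAt.of_le (by simp)).clm_comp
      (h1.comp z (hMs.contDiffAt.of_le (by simp)))
  · rintro z ⟨e, he⟩ hz v hv
    have hM : ∀ u, π (K z u) = e u := fun u => congrArg (fun L => L u) he.symm
    have hinj : Function.Injective (K z) := fun u v huv => e.injective (by rw [← hM, ← hM, huv])
    have hr : (K z).range = Φ.dist z := by
      refine Submodule.eq_of_le_of_finrank_eq ?_ ?_
      · rintro _ ⟨u, rfl⟩; exact hKD z u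
      · rw [hz]; exact (LinearMap.finrank_range_of_inj hinj).trans (by simp)
    rw [← hr] at hv
    obtain ⟨u, rfl⟩ := hv
    have : (π.comp (K z)).inverse (π (K z u)) = u := by
      rw [← he, ContinuousLinearMap.inverse_equiv, hM]; simp
    exact (congrArg (K z) this).symm

/-- The set underlying a leaf, without the topology induced by the ambient space. -/
@[ext]
structure LeafSpace {E : Type*} (O : Set E) where
  val : E
  mem : val ∈ O

namespace Plaque

variable {E : Type*} [NormedAddCommGroup E] [NormedSpace ℝ E] {D : E → Submodule ℝ E}
  {O : Set E} {d : ℕ}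

open Classical in
/-- The projection of a plaque, as a chart on the leaf. -/
noncomputable def chart {b : LeafSpace O} (P : Plaque D O d b.1) :
    PartialEquiv (LeafSpace O) (EuclideanSpace ℝ (Fin d)) where
  toFun z := P.proj z.1
  -- Off `P.dom` the value `b` is arbitrary.
  invFun u := if h : u ∈ P.dom then ⟨P.sect u, P.sect_mem u h⟩ else b
  source := {z | z.1 ∈ P.carrier}
  target := P.dom
  map_source' _ hz := hz.1
  map_target' u hu := by
    change (dite _ _ _ : LeafSpace O).val ∈ P.carrier
    rw [dif_pos hu]
    exact ⟨by rwa [P.proj_sect u hu], by rw [P.proj_sect u hu]⟩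
  left_inv' z hz := by
    rw [dif_pos hz.1]
    exact LeafSpace.ext hz.2
  right_inv' u hu := by
    rw [dif_pos hu]
    exact P.proj_sect u hu

lemma chart_symm_val {b : LeafSpace O} (P : Plaque D O d b.1) {u : EuclideanSpace ℝ (Fin d)}
    (hu : u ∈ P.dom) : (P.chart.symm u).1 = P.sect u := by
  simp only [chart, PartialEquiv.coe_symm_mk, dif_pos hu]

/-- This makes overlaps of plaques open in each chart, which is what the leaf topology requires. -/
lemma eventually_sect_mem {b : LeafSpace O} (P : Plaque D O d b.1)
    {c : E} (Q : Plaque D O d c) {u : EuclideanSpace ℝ (Fin d)} (hu : u ∈ P.dom)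
    (h : P.sect u ∈ Q.carrier) : ∀ᶠ w in 𝓝 u, P.sect w ∈ Q.carrier := by
  refine Q.eventually_mem_carrier ((P.contDiffAt_sect u hu).of_le (by simp)) h ?_
  filter_upwards [P.isOpen_dom.mem_nhds hu] with w hw
  refine ⟨fun v => ?_, P.finrank_dist hw⟩
  rw [← P.range_fderiv w hw]
  exact ⟨v, rfl⟩

lemma transition_source {b c : LeafSpace O} (P : Plaque D O d b.1) (Q : Plaque D O d c.1) :
    (P.chart.symm.trans Q.chart).source = {u | u ∈ P.dom ∧ P.sect u ∈ Q.carrier} := by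
  ext u
  rw [PartialEquiv.trans_source]
  refine and_congr_right fun hu => ?_
  change (P.chart.symm u).1 ∈ Q.carrier ↔ _
  rw [P.chart_symm_val hu]

lemma isOpen_transition_source {b c : LeafSpace O} (P : Plaque D O d b.1)
    (Q : Plaque D O d c.1) : IsOpen (P.chart.symm.trans Q.chart).source := by
  rw [transition_source, isOpen_iff_mem_nhds]
  rintro u ⟨hu, h⟩
  exact Filter.inter_mem (P.isOpen_dom.mem_nhds hu) (P.eventually_sect_mem Q hu h)

lemma contDiffOn_transition {b c : LeafSpace O} (P : Plaque D O d b.1)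
    (Q : Plaque D O d c.1) :
    ContDiffOn ℝ ∞ (P.chart.symm.trans Q.chart) (P.chart.symm.trans Q.chart).source := by
  have h : ContDiffOn ℝ ∞ (fun u => Q.proj (P.sect u)) (P.chart.symm.trans Q.chart).source := by
    rw [transition_source]
    exact fun u hu =>
      (Q.proj.contDiff.contDiffAt.comp u (P.contDiffAt_sect u hu.1)).contDiffWithinAt
  refine h.congr fun u hu => ?_
  rw [transition_source] at hu
  change Q.proj (P.chart.symm u).1 = _
  rw [P.chart_symm_val hu.1]

/-- The charts given by the plaques. -/
noncomputable def chartedSpaceCore (P : ∀ b : LeafSpace O, Plaque D O d b.1) :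
    ChartedSpaceCore (EuclideanSpace ℝ (Fin d)) (LeafSpace O) where
  atlas := range fun b => (P b).chart
  chartAt b := (P b).chart
  mem_chart_source b := (P b).self_mem
  chart_mem_atlas b := ⟨b, rfl⟩
  open_source := by
    rintro _ _ ⟨b, rfl⟩ ⟨c, rfl⟩
    exact isOpen_transition_source _ _
  continuousOn_toFun := by
    rintro _ _ ⟨b, rfl⟩ ⟨c, rfl⟩
    exact (contDiffOn_transition _ _).continuousOn

lemma finrank_eq {a : E} (P : Plaque D O d a) : Module.finrank ℝ (D a) = d := by
  have := P.finrank_dist P.proj_mem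
  rwa [P.sect_proj] at this

/-- A set covered by plaques is the image of a manifold, injectively immersed with tangent spaces
given by the distribution; curves tangent to the distribution are continuous in this manifold. -/
theorem exists_manifold (P : ∀ b : LeafSpace O, Plaque D O d b.1) :
    ∃ (_ : TopologicalSpace (LeafSpace O))
      (_ : ChartedSpace (EuclideanSpace ℝ (Fin d)) (LeafSpace O))
      (_ : IsManifold (𝓡 d) ∞ (LeafSpace O)),
      ContMDiff (𝓡 d) 𝓘(ℝ, E) ∞ (LeafSpace.val : LeafSpace O → E) ∧
      (∀ p : LeafSpace O,
        Function.Injective (mfderiv (𝓡 d) 𝓘(ℝ, E) (LeafSpace.val : LeafSpace O → E) p) ∧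
        ∀ v : E, v ∈ D p.1 ↔
          ∃ u, mfderiv (𝓡 d) 𝓘(ℝ, E) (LeafSpace.val : LeafSpace O → E) p u = v) ∧
      ∀ c : ℝ → LeafSpace O, ContDiff ℝ 1 (fun t => (c t).1) →
        (∀ t, deriv (fun t => (c t).1) t ∈ D (c t).1) → Continuous c := by
  let core := chartedSpaceCore P
  let : TopologicalSpace (LeafSpace O) := core.toTopologicalSpace
  let : ChartedSpace (EuclideanSpace ℝ (Fin d)) (LeafSpace O) := core.toChartedSpace
  have hman : IsManifold (𝓡 d) ∞ (LeafSpace O) := by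
    refine isManifold_of_contDiffOn _ _ _ ?_
    intro e e' he he'
    obtain ⟨_, h1⟩ := mem_iUnion.1 he
    obtain ⟨h2, h3⟩ := mem_iUnion.1 h1
    obtain ⟨_, h1'⟩ := mem_iUnion.1 he'
    obtain ⟨h2', h3'⟩ := mem_iUnion.1 h1'
    rw [mem_singleton_iff] at h3 h3'
    subst h3 h3'
    obtain ⟨b, rfl⟩ := h2
    obtain ⟨c, rfl⟩ := h2'
    exact (contDiffOn_transition (P b) (P c)).mono inter_subset_left
  have hchart : ∀ p : LeafSpace O, ∀ u ∈ (P p).dom,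
      ((chartAt (EuclideanSpace ℝ (Fin d)) p).symm u).1 = (P p).sect u :=
    fun p u hu => (P p).chart_symm_val hu
  have hwr : ∀ p : LeafSpace O, (LeafSpace.val ∘ (extChartAt (𝓡 d) p).symm)
      =ᶠ[𝓝 ((P p).proj p.1)] (P p).sect := by
    intro p
    filter_upwards [(P p).isOpen_dom.mem_nhds (P p).proj_mem] with u hu
    simpa using hchart p u hu
  have hext : ∀ p : LeafSpace O, extChartAt (𝓡 d) p p = (P p).proj p.1 := fun p => rfl
  have hsm : ContMDiff (𝓡 d) 𝓘(ℝ, E) ∞ (LeafSpace.val : LeafSpace O → E) := by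
    intro p
    rw [contMDiffAt_iff_source, contMDiffWithinAt_iff_contDiffWithinAt, hext]
    exact (((P p).contDiffAt_sect _ (P p).proj_mem).congr_of_eventuallyEq
      (hwr p)).contDiffWithinAt
  refine ⟨inferInstance, inferInstance, hman, hsm, fun p => ?_, fun c hc hcD => ?_⟩
  · have hmf : mfderiv (𝓡 d) 𝓘(ℝ, E) (LeafSpace.val : LeafSpace O → E) p =
        fderiv ℝ (P p).sect ((P p).proj p.1) := by
      rw [((hsm p).mdifferentiableAt (by simp)).mfderiv, hext]
      simp only [modelWithCornersSelf_coe, range_id, fderivWithin_univ]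
      exact (hwr p).fderiv_eq
    rw [hmf]
    refine ⟨(P p).injective_fderiv (P p).proj_mem, fun v => ?_⟩
    have hr := (P p).range_fderiv _ (P p).proj_mem
    rw [(P p).sect_proj] at hr
    rw [← hr]
    rfl
  -- Near each time the curve stays in the plaque through `c t`, where continuity in the leaf
  -- topology is continuity of the projected curve.
  · refine continuous_iff_continuousAt.2 fun t => ?_
    have hev := (P (c t)).eventually_mem_carrier hc.contDiffAt (P (c t)).self_mem
      (Eventually.of_forall fun s => ⟨fun v => ?_, (P (c s)).finrank_eq⟩)
    · rw [(chartAt (EuclideanSpace ℝ (Fin d)) (c t)).continuousAt_iff_continuousAt_comp_left hev]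
      exact ((P (c t)).proj.continuous.comp hc.continuous).continuousAt
    · have : fderiv ℝ (fun t => (c t).1) s v = v • deriv (fun t => (c t).1) s := by
        rw [← fderiv_apply_one_eq_deriv, ← map_smul]; simp
      rw [this]
      exact Submodule.smul_mem _ _ (hcD s)

end Plaque

end OrbitManifold

/-! ### Maximal integral manifolds are orbits. -/

section Leaves

open Set Filter Topology

namespace FlowFamily

variable {ι : Type*} {n : ℕ} (Φ : FlowFamily ι (MatSpace n))

/-- Plaques give the manifold structure. For connectedness, flow lines are tangent to the
distribution, hence continuous in the leaf topology, so each flow step stays in the connected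
component of `a`. -/
theorem isIntegralManifold_orbit (a : MatSpace n) :
    IsIntegralManifold (fun x => (Φ.dist x : Set (MatSpace n))) (Φ.orbit a) := by
  have hP : ∀ b : LeafSpace (Φ.orbit a),
      Nonempty (Plaque Φ.dist (Φ.orbit a) (Module.finrank ℝ (Φ.dist a)) b.val) := by
    rintro ⟨b, hb⟩
    have h := Φ.exists_plaque b
    rwa [Φ.finrank_dist_orbit hb, Φ.orbit_eq hb] at h
  obtain ⟨_, _, hman, hsm, hmf, hcurve⟩ := Plaque.exists_manifold fun b => (hP b).some
  have hconn : ConnectedSpace (LeafSpace (Φ.orbit a)) := by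
    rw [connectedSpace_iff_connectedComponent]
    refine ⟨⟨a, Φ.mem_orbit_self a⟩, eq_univ_of_forall ?_⟩
    rintro ⟨b, hb⟩
    induction hb with
    | refl => exact mem_connectedComponent
    | @tail y z hy h ih =>
      obtain ⟨k, t, rfl⟩ := h
      let c : ℝ → LeafSpace (Φ.orbit a) := fun s => ⟨Φ.flow k s y, Φ.flow_mem_orbit hy k s⟩
      have hc : Continuous c := by
        refine hcurve c ((Φ.contDiff_flow_time k y).of_le (by simp)) fun s => ?_
        rw [(Φ.hasDerivAt_flow k s y).deriv]
        exact Φ.field_mem k _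
      have h0 : c 0 = ⟨y, hy⟩ := LeafSpace.ext (Φ.flow_zero k y)
      have hpre : IsPreconnected (range c) := isPreconnected_range hc
      have hmem := hpre.subset_connectedComponent ⟨0, h0⟩ ⟨t, rfl⟩
      exact (connectedComponent_eq ih).symm ▸ hmem
  refine ⟨_, LeafSpace (Φ.orbit a), _, _, hman, hconn, LeafSpace.val,
    fun x y h => LeafSpace.ext h, ?_, hsm, hmf⟩
  ext b
  exact ⟨fun ⟨x, hx⟩ => hx ▸ x.mem, fun h => ⟨⟨b, h⟩, rfl⟩⟩

/-- By the plaques, every point of the manifold has a neighbourhood mapped into a single orbit. The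
preimages of the orbits are therefore open and partition a connected space. -/
theorem subset_orbit_of_isIntegralManifold {L : Set (MatSpace n)}
    (hL : IsIntegralManifold (fun x => (Φ.dist x : Set (MatSpace n))) L) {b : MatSpace n}
    (hb : b ∈ L) : L ⊆ Φ.orbit b := by
  obtain ⟨d, N, _, _, hman, hconn, g, hinj, rfl, hg, hT⟩ := hL
  have hrank : ∀ p, Module.finrank ℝ (Φ.dist (g p)) = d := by
    intro p
    let T : EuclideanSpace ℝ (Fin d) →L[ℝ] MatSpace n := mfderiv (𝓡 d) 𝓘(ℝ, MatSpace n) g p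
    have h1 : Φ.dist (g p) = T.range := Submodule.ext fun v => (hT p).2 v
    rw [h1]
    exact (LinearMap.finrank_range_of_inj (f := T.toLinearMap) (hT p).1).trans finrank_euclideanSpace_fin
  have hopen : ∀ p, ∀ᶠ x in 𝓝 p, g x ∈ Φ.orbit (g p) := by
    intro p
    obtain ⟨P⟩ := Φ.exists_plaque (g p)
    rw [hrank] at P
    let φ := extChartAt (𝓡 d) p
    have hφ : ∀ y ∈ φ.target, ContMDiffAt 𝓘(ℝ, EuclideanSpace ℝ (Fin d)) (𝓡 d) ∞ φ.symm y :=
      fun y hy => (contMDiffOn_extChartAt_symm p).contMDiffAt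
        ((isOpen_extChartAt_target p).mem_nhds hy)
    have hf : ∀ y ∈ φ.target, ContDiffAt ℝ ∞ (g ∘ φ.symm) y := fun y hy =>
      contMDiffAt_iff_contDiffAt.1 ((hg _).comp y (hφ y hy))
    have hp : φ p ∈ φ.target := mem_extChartAt_target p
    have hφp : φ.symm (φ p) = p := extChartAt_to_inv p
    have hev := P.eventually_mem_carrier (g := g ∘ φ.symm) (p := φ p)
      ((hf _ hp).of_le (by simp)) (by rw [Function.comp_apply, hφp]; exact P.self_mem) (by
        filter_upwards [(isOpen_extChartAt_target p).mem_nhds hp] with y hy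
        refine ⟨fun v => ?_, hrank _⟩
        have h1 : fderiv ℝ (g ∘ φ.symm) y v = mfderiv (𝓡 d) 𝓘(ℝ, MatSpace n) g (φ.symm y)
            (mfderiv 𝓘(ℝ, EuclideanSpace ℝ (Fin d)) (𝓡 d) φ.symm y v) := by
          rw [← mfderiv_eq_fderiv, mfderiv_comp y ((hg _).mdifferentiableAt (by simp))
            ((hφ y hy).mdifferentiableAt (by simp))]
          rfl
        rw [h1]
        exact ((hT _).2 _).2 ⟨_, rfl⟩)
    filter_upwards [(continuousAt_extChartAt (I := 𝓡 d) p).eventually hev,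
      extChartAt_source_mem_nhds (I := 𝓡 d) p] with x hx hxs
    rw [Function.comp_apply, φ.left_inv hxs] at hx
    exact P.carrier_subset hx
  have hcl : IsClopen {x | g x ∈ Φ.orbit b} := by
    refine ⟨⟨isOpen_iff_mem_nhds.2 fun x hx => ?_⟩, isOpen_iff_mem_nhds.2 fun x hx => ?_⟩
    · filter_upwards [hopen x] with y hy hyb
      exact hx (Φ.orbit_subset hyb (Φ.orbit_symm hy))
    · filter_upwards [hopen x] with y hy
      exact Φ.orbit_subset hx hy
  obtain ⟨p₀, rfl⟩ := hb
  have huniv := hcl.eq_univ ⟨p₀, Φ.mem_orbit_self _⟩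
  rintro _ ⟨x, rfl⟩
  exact (huniv ▸ mem_univ x : x ∈ {x | g x ∈ Φ.orbit (g p₀)})

/-- The maximal integral manifolds of the distribution are the orbits. -/
theorem maximal_isIntegralManifold_iff (L : Set (MatSpace n)) :
    Maximal (IsIntegralManifold (fun x => (Φ.dist x : Set (MatSpace n)))) L ↔
      ∃ a, L = Φ.orbit a := by
  constructor
  · intro h
    obtain ⟨b, hb⟩ : L.Nonempty := by
      obtain ⟨d, N, _, _, _, hconn, g, -, rfl, -⟩ := h.prop
      exact range_nonempty g
    have hsub := Φ.subset_orbit_of_isIntegralManifold h.prop hb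
    exact ⟨b, hsub.antisymm (h.le_of_ge (Φ.isIntegralManifold_orbit b) hsub)⟩
  · rintro ⟨a, rfl⟩
    exact ⟨Φ.isIntegralManifold_orbit a, fun L hL hle =>
      Φ.subset_orbit_of_isIntegralManifold hL (hle (Φ.mem_orbit_self a))⟩

end FlowFamily

end Leaves

/-! ### An involutive span is preserved by the flow. -/

section FlowInvariance

open Set

/-- If the commutators of a vector field `X` with the members of a finite family of vector fields
`Y` are combinations of these with continuous coefficients, then the flow of `X` maps the spans of
the values of `Y` into one another. -/
theorem fderiv_flow_mem_span {E : Type*} [NormedAddCommGroup E] [NormedSpace ℂ E]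
    [FiniteDimensional ℂ E] {κ : Type*} [Fintype κ] {ψ : ℂ → E → E}
    (hψ : ContDiff ℂ ∞ fun p : ℂ × E => ψ p.1 p.2) (h0 : ∀ x, ψ 0 x = x)
    (hadd : ∀ s t x, ψ (s + t) x = ψ s (ψ t x)) {X : E → E} (hX : ContDiff ℂ ∞ X)
    (hψX : ∀ t x, HasDerivAt (fun s => ψ s x) (X (ψ t x)) t) {Y : κ → E → E}
    (hY : ∀ l, ContDiff ℂ ∞ (Y l)) {c : κ → κ → E → ℂ} (hc : ∀ l m, Continuous (c l m))
    (hbr : ∀ l z, fderiv ℂ (Y l) z (X z) - fderiv ℂ X z (Y l z) = ∑ m, c l m z • Y m z)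
    (τ : ℂ) (x v : E) (hv : v ∈ Submodule.span ℂ (range fun l => Y l x)) :
    fderiv ℂ (ψ τ) x v ∈ Submodule.span ℂ (range fun l => Y l (ψ τ x)) := by
  have hψt : ∀ t, ContDiff ℂ ∞ (ψ t) := fun t => hψ.comp (contDiff_const.prodMk contDiff_id)
  have hψd : ∀ t z, HasFDerivAt (ψ t) (fderiv ℂ (ψ t) z) z := fun t z =>
    ((hψt t).differentiable (by simp) z).hasFDerivAt
  set DΨ := fderiv ℂ (fun p : ℂ × E => ψ p.1 p.2) with hDΨ
  have hDs : ContDiff ℂ ∞ DΨ := hψ.fderiv_right (by simp)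
  have hDh : ∀ p : ℂ × E, HasFDerivAt (fun p : ℂ × E => ψ p.1 p.2) (DΨ p) p := fun p =>
    (hψ.differentiable (by simp) p).hasFDerivAt
  have hD1 : ∀ t z, DΨ (t, z) (1, 0) = X (ψ t z) := by
    intro t z
    have h1 := (hDh (t, z)).comp_hasDerivAt t ((hasDerivAt_id t).prodMk (hasDerivAt_const t z))
    exact h1.unique (hψX t z)
  have hD2 : ∀ t z, (DΨ (t, z)).comp (ContinuousLinearMap.inr ℂ ℂ E) = fderiv ℂ (ψ t) z := by
    intro t z
    exact ((hDh (t, z)).comp z (hasFDerivAt_prodMk_right t z)).unique (hψd t z)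
  have hinv : ∀ t z, ψ (-t) (ψ t z) = z := fun t z => by rw [← hadd, neg_add_cancel, h0]
  have hBA : ∀ t z, (fderiv ℂ (ψ (-t)) (ψ t z)).comp (fderiv ℂ (ψ t) z) =
      ContinuousLinearMap.id ℂ E := by
    intro t z
    have h1 := (hψd (-t) (ψ t z)).comp z (hψd t z)
    have h2 : ψ (-t) ∘ ψ t = id := funext (hinv t)
    rw [h2] at h1
    exact h1.unique (hasFDerivAt_id z)
  have hAB : ∀ t z u, fderiv ℂ (ψ t) z (fderiv ℂ (ψ (-t)) (ψ t z) u) = u := by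
    intro t z u
    have h1 := congrArg (fun L => L u) (hBA (-t) (ψ t z))
    rw [neg_neg, hinv] at h1
    exact h1
  -- The variational equation, obtained by exchanging the time and space derivatives of `ψ`.
  have hA' : ∀ s z, HasDerivAt (fun s => fderiv ℂ (ψ s) z)
      ((fderiv ℂ X (ψ s z)).comp (fderiv ℂ (ψ s) z)) s := by
    intro s z
    have h1 : HasDerivAt (fun s => DΨ (s, z)) (fderiv ℂ DΨ (s, z) (1, 0)) s :=
      (hDs.differentiable (by simp) (s, z)).hasFDerivAt.comp_hasDerivAt s
        ((hasDerivAt_id s).prodMk (hasDerivAt_const s z))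
    have h2 := h1.clm_comp (hasDerivAt_const s (ContinuousLinearMap.inr ℂ ℂ E))
    simp only [hD2, ContinuousLinearMap.comp_zero, add_zero] at h2
    convert h2 using 1
    ext1 u
    have hsymm : fderiv ℂ DΨ (s, z) (1, 0) (0, u) = fderiv ℂ DΨ (s, z) (0, u) (1, 0) :=
      ((hψ.contDiffAt (x := (s, z))).isSymmSndFDerivAt
        (by rw [minSmoothness_of_isRCLikeNormedField]; exact WithTop.coe_le_coe.2 le_top)).eq _ _
    have h3 : HasFDerivAt (fun y => DΨ (s, y) (1, 0))
        ((ContinuousLinearMap.apply ℂ E ((1, 0) : ℂ × E)).comp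
          ((fderiv ℂ DΨ (s, z)).comp (ContinuousLinearMap.inr ℂ ℂ E))) z :=
      (ContinuousLinearMap.apply ℂ E ((1, 0) : ℂ × E)).hasFDerivAt.comp z
        ((hDs.differentiable (by simp) (s, z)).hasFDerivAt.comp z (hasFDerivAt_prodMk_right s z))
    have h4 : HasFDerivAt (fun y => X (ψ s y))
        ((fderiv ℂ X (ψ s z)).comp (fderiv ℂ (ψ s) z)) z :=
      (hX.differentiable (by simp) (ψ s z)).hasFDerivAt.comp z (hψd s z)
    simp only [hD1] at h3
    have h5 := congrArg (fun L => L u) (h4.unique h3)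
    exact h5.trans hsymm.symm
  -- Differentiability is shown first; the value of the derivative then follows by differentiating
  -- `hBA`.
  have hB' : ∀ s z, HasDerivAt (fun s => fderiv ℂ (ψ (-s)) (ψ s z))
      (-((fderiv ℂ (ψ (-s)) (ψ s z)).comp (fderiv ℂ X (ψ s z)))) s := by
    intro s z
    obtain ⟨B', hB⟩ : ∃ B', HasDerivAt (fun s => fderiv ℂ (ψ (-s)) (ψ s z)) B' s := by
      have h1 := (hDs.differentiable (by simp) (-s, ψ s z)).hasFDerivAt.comp_hasDerivAt s
        ((hasDerivAt_neg s).prodMk (hψX s z))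
      have h2 := h1.clm_comp (hasDerivAt_const s (ContinuousLinearMap.inr ℂ ℂ E))
      simp only [Function.comp_apply, hD2] at h2
      exact ⟨_, h2⟩
    have h1 := hB.clm_comp (hA' s z)
    simp only [hBA] at h1
    have h2 := h1.unique (hasDerivAt_const s _)
    have h3 : B' = -((fderiv ℂ (ψ (-s)) (ψ s z)).comp (fderiv ℂ X (ψ s z))) := by
      ext1 u
      have h4 := congrArg (fun L => L (fderiv ℂ (ψ (-s)) (ψ s z) u)) h2
      simp only [add_apply, ContinuousLinearMap.comp_apply, hAB, zero_apply] at h4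
      simpa using eq_neg_of_add_eq_zero_left h4
    rwa [← h3]
  -- A functional that kills the span at `z`, applied to the pulled-back fields, gives functions `y
  -- l` of time. By the commutator relations they solve a homogeneous linear system with zero
  -- initial value, so they vanish and no functional separates the pullback from the span.
  have key : ∀ z τ l, fderiv ℂ (ψ (-τ)) (ψ τ z) (Y l (ψ τ z)) ∈
      Submodule.span ℂ (range fun l => Y l z) := by
    intro z τ l
    by_contra hcon
    obtain ⟨lam, hlam, hker⟩ := Submodule.exists_le_ker_of_notMem hcon
    let lam' : E →L[ℂ] ℂ := LinearMap.toContinuousLinearMap lam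
    let y : κ → ℂ → ℂ := fun l s => lam' (fderiv ℂ (ψ (-s)) (ψ s z) (Y l (ψ s z)))
    have hy : ∀ l s, HasDerivAt (y l) (∑ m, c l m (ψ s z) * y m s) s := by
      intro l s
      have h1 : HasDerivAt (fun s => Y l (ψ s z)) (fderiv ℂ (Y l) (ψ s z) (X (ψ s z))) s :=
        ((hY l).differentiable (by simp) (ψ s z)).hasFDerivAt.comp_hasDerivAt s (hψX s z)
      have h2 := lam'.hasFDerivAt.comp_hasDerivAt s ((hB' s z).clm_apply h1)
      have h3 := congrArg (fun u => lam' (fderiv ℂ (ψ (-s)) (ψ s z) u)) (hbr l (ψ s z))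
      simp only [map_sub, map_sum, map_smul, smul_eq_mul] at h3
      refine h2.congr_deriv ?_
      refine Eq.trans ?_ h3
      simp only [neg_apply, ContinuousLinearMap.comp_apply, map_add, map_neg]
      ring
    -- Restriction to the real segment from `0` to `τ` allows Grönwall's inequality.
    have hyr : ∀ r : ℝ, HasDerivAt (fun r : ℝ => fun l => y l (r * τ))
        (fun l => τ * ∑ m, c l m (ψ (r * τ) z) * y m (r * τ)) r := by
      intro r
      refine hasDerivAt_pi.2 fun l => ?_
      have h1 : HasDerivAt (fun r : ℝ => (r : ℂ) * τ) τ r := by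
        simpa using (Complex.ofRealCLM.hasDerivAt (x := r)).mul_const τ
      rw [mul_comm]
      exact HasDerivAt.comp_of_eq (h₂ := y l) (y := (r : ℂ) * τ) r (hy l _) h1 rfl
    have hψc : Continuous fun r : ℝ => ψ (r * τ) z :=
      hψ.continuous.comp ((Complex.continuous_ofReal.mul continuous_const).prodMk continuous_const)
    obtain ⟨C, hC⟩ := isCompact_Icc.exists_bound_of_continuousOn (s := Icc (0 : ℝ) 1)
      (f := fun r : ℝ => ‖τ‖ * ∑ l, ∑ m, ‖c l m (ψ (r * τ) z)‖)
      (Continuous.continuousOn (continuous_const.mul (continuous_finsetSum _ fun l _ =>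
        continuous_finsetSum _ fun m _ => ((hc l m).comp hψc).norm)))
    have hzero := eq_zero_of_abs_deriv_le_mul_abs_self_of_eq_zero_right
      (f := fun r : ℝ => fun l => y l (r * τ)) (K := C) (a := 0) (b := 1)
      (fun r _ => (hyr r).continuousAt.continuousWithinAt)
      (fun r _ => (hyr r).hasDerivWithinAt) (by
        funext l
        have hid : ψ 0 = id := funext h0
        have : lam (Y l z) = 0 := hker (Submodule.subset_span ⟨l, rfl⟩)
        simpa [y, hid, lam'] using this) (fun r hr => by
        have hb := hC r (Ico_subset_Icc_self hr)
        refine (pi_norm_le_iff_of_nonneg (mul_nonneg ((norm_nonneg _).trans hb)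
          (norm_nonneg _))).2 fun l => ?_
        have h1 : ‖∑ m, c l m (ψ (r * τ) z) * y m (r * τ)‖ ≤
            (∑ l, ∑ m, ‖c l m (ψ (r * τ) z)‖) * ‖fun l => y l (r * τ)‖ := by
          refine (norm_sum_le _ _).trans ?_
          have h2 : ∑ m, ‖c l m (ψ (r * τ) z)‖ ≤ ∑ l, ∑ m, ‖c l m (ψ (r * τ) z)‖ :=
            Finset.single_le_sum (f := fun l => ∑ m, ‖c l m (ψ (r * τ) z)‖)
              (fun l _ => Finset.sum_nonneg fun m _ => norm_nonneg _) (Finset.mem_univ l)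
          refine le_trans ?_ (mul_le_mul_of_nonneg_right h2 (norm_nonneg _))
          rw [Finset.sum_mul]
          refine Finset.sum_le_sum fun m _ => ?_
          rw [norm_mul]
          exact mul_le_mul_of_nonneg_left
            (norm_le_pi_norm (fun l => y l (r * τ)) m) (norm_nonneg _)
        rw [norm_mul]
        calc _ ≤ ‖τ‖ * ((∑ l, ∑ m, ‖c l m (ψ (r * τ) z)‖) * ‖fun l => y l (r * τ)‖) := by gcongr
          _ = (‖τ‖ * ∑ l, ∑ m, ‖c l m (ψ (r * τ) z)‖) * ‖fun l => y l (r * τ)‖ := by ring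
          _ ≤ _ := mul_le_mul_of_nonneg_right ((le_abs_self _).trans hb) (norm_nonneg _)) 1
      (by simp)
    have := congrFun hzero l
    simp only [Complex.ofReal_one, one_mul, Pi.zero_apply] at this
    exact hlam this
  have hle : Submodule.span ℂ (range fun l => Y l x) ≤
      (Submodule.span ℂ (range fun l => Y l (ψ τ x))).comap (fderiv ℂ (ψ τ) x).toLinearMap := by
    rw [Submodule.span_le]
    rintro _ ⟨l, rfl⟩
    have := key (ψ τ x) (-τ) l
    rw [neg_neg, hinv] at this
    exact this
  exact hle hv

end FlowInvariance

/-! ### The Jacobi identity and the explicit Hamiltonian flows. -/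

section PoissonFlows

open Set

/-- The twist exponents are antisymmetrizations of sums of terms depending on one index of each of
the two pairs. -/
lemma exists_twistExponent_eq {n : ℕ} (w : Modification n) :
    ∃ p q r u : Fin n → Fin n → ℤ, ∀ i j s t, twistExponent w i j s t =
      (p s i + q s j + r t i + u t j) - (p i s + q i t + r j s + u j t) := by
  let A : Fin n → Weight n → ℤ := fun i l =>
    l (Sum.inl ()) + ∑ k : Fin (n - 1), (if k.val < i.val then 1 else 0) * l (Sum.inr (Sum.inl k))
  let B : Fin n → Weight n → ℤ := fun j l =>
    ∑ k : Fin (n - 1), (if k.val < j.val then 1 else 0) * l (Sum.inr (Sum.inr k))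
  have hAB : ∀ i j l, rootPairing (alphaRoot i j) l = A i l + B j l := by
    intro i j l
    simp only [rootPairing, Fintype.sum_sum_type, alphaRoot, A, B]
    simp [add_assoc]
  have hadd : ∀ (i j : Fin n) (l l' : Weight n), rootPairing (alphaRoot i j) (l + l') =
      rootPairing (alphaRoot i j) l + rootPairing (alphaRoot i j) l' := by
    intro i j l l'
    simp [rootPairing, mul_add, Finset.sum_add_distrib]
  refine ⟨fun s i => A s (w.zeta i), fun s j => A s (w.xi j), fun t i => B t (w.zeta i),
    fun t j => B t (w.xi j), fun i j s t => ?_⟩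
  simp only [twistExponent, hadd, hAB]
  ring

lemma twistExponent_self {n : ℕ} (w : Modification n) (i j : Fin n) :
    twistExponent w i j i j = 0 := sub_self _

lemma twistExponent_swap {n : ℕ} (w : Modification n) (i j s t : Fin n) :
    twistExponent w s t i j = -twistExponent w i j s t := by
  simp [twistExponent]

/-- The coefficient of `a_{i,t} a_{s,j}` in `{a_{i,j}, a_{s,t}}`. -/
def signSum {n : ℕ} (i j s t : Fin n) : ℤ :=
  Int.sign ((s.val : ℤ) - i.val) + Int.sign ((t.val : ℤ) - j.val)

lemma poissonBracket_eq {n : ℕ} (w : Modification n) (a : MatSpace n) (i j s t : Fin n) :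
    poissonBracket w a i j s t =
      signSum i j s t * (a i t * a s j) + twistExponent w i j s t * (a s t * a i j) := by
  simp [poissonBracket, bracketExpr, signSum]

/-- The differential of the function `{a_{i,j}, a_{s,t}}` in the direction `v`. -/
noncomputable def bracketDeriv {n : ℕ} (w : Modification n) (a : MatSpace n) (i j s t : Fin n)
    (v : MatSpace n) : ℂ :=
  signSum i j s t * (v i t * a s j + a i t * v s j) +
    twistExponent w i j s t * (v s t * a i j + a s t * v i j)

/-- Besides antisymmetry, this is all that the Jacobi identity uses about the signs. -/
lemma sign_cyclic {n : ℕ} (i k s : Fin n) :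
    Int.sign ((k.val : ℤ) - i.val) * Int.sign ((s.val : ℤ) - i.val) -
      Int.sign ((s.val : ℤ) - k.val) * Int.sign ((k.val : ℤ) - i.val) +
      Int.sign ((s.val : ℤ) - i.val) * Int.sign ((s.val : ℤ) - k.val) =
      if i = k ∧ k = s then 0 else 1 := by
  have key : ∀ x y : Fin n, x < y ∧ Int.sign ((y.val : ℤ) - x.val) = 1 ∨
      x = y ∧ Int.sign ((y.val : ℤ) - x.val) = 0 ∨ y < x ∧ Int.sign ((y.val : ℤ) - x.val) = -1 := by
    intro x y
    rcases lt_trichotomy x y with h | h | h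
    · exact Or.inl ⟨h, Int.sign_eq_one_of_pos (by have := Fin.lt_def.1 h; omega)⟩
    · exact Or.inr (Or.inl ⟨h, by simp [h]⟩)
    · exact Or.inr (Or.inr ⟨h, Int.sign_eq_neg_one_of_neg (by have := Fin.lt_def.1 h; omega)⟩)
  rcases key i k with ⟨h1, e1⟩ | ⟨h1, e1⟩ | ⟨h1, e1⟩ <;>
  rcases key k s with ⟨h2, e2⟩ | ⟨h2, e2⟩ | ⟨h2, e2⟩ <;>
  rcases key i s with ⟨h3, e3⟩ | ⟨h3, e3⟩ | ⟨h3, e3⟩ <;>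
  rw [e1, e2, e3] <;> split_ifs <;> first | rfl | (exfalso; omega)

/-- The Jacobi identity for the coordinate functions. -/
lemma bracket_jacobi {n : ℕ} (w : Modification n) (a : MatSpace n) (i j k l s t : Fin n) :
    bracketDeriv w a k l s t (fun x y => poissonBracket w a i j x y) -
      bracketDeriv w a i j s t (fun x y => poissonBracket w a k l x y) =
    signSum i j k l * (a k j * poissonBracket w a i l s t + a i l * poissonBracket w a k j s t) +
      twistExponent w i j k l *
        (a i j * poissonBracket w a k l s t + a k l * poissonBracket w a i j s t) := by
  obtain ⟨p, q, r, u, hw⟩ := exists_twistExponent_eq w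
  have anti : ∀ x y : Fin n, Int.sign ((y.val : ℤ) - x.val) = -Int.sign ((x.val : ℤ) - y.val) :=
    fun x y => by rw [← Int.sign_neg, neg_sub]
  -- The cyclic sign sums for rows and columns enter only through their difference, times a cubic
  -- expression. The difference is zero unless exactly one of the triples is constant, and then the
  -- cubic vanishes.
  have hprod : ((if i = k ∧ k = s then 0 else 1) - (if j = l ∧ l = t then 0 else 1) : ℂ) *
      (a i t * a s l * a k j - a i l * a k t * a s j) = 0 := by
    by_cases h1 : i = k ∧ k = s
    · obtain ⟨rfl, rfl⟩ := h1
      ring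
    · by_cases h2 : j = l ∧ l = t
      · obtain ⟨rfl, rfl⟩ := h2
        ring
      · simp [h1, h2]
  have hr := congrArg (Int.cast : ℤ → ℂ) (sign_cyclic i k s)
  have hc := congrArg (Int.cast : ℤ → ℂ) (sign_cyclic j l t)
  push_cast at hr hc
  rw [← hr, ← hc] at hprod
  simp only [bracketDeriv, poissonBracket_eq, signSum, hw]
  rw [anti k i, anti l j]
  push_cast
  linear_combination -hprod

/-- With `signSum_add`, this says that the growth rates of `a_{p,t}` and `a_{s,q}` along the flow of
`a_{p,q}` add up to the total exponent for `(s,t)`, which is why the flow integrates in closed form.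
-/
lemma twistExponent_add {n : ℕ} (w : Modification n) (p q s t : Fin n) :
    twistExponent w p q p t + twistExponent w p q s q = twistExponent w p q s t := by
  obtain ⟨P, Q, R, U, hw⟩ := exists_twistExponent_eq w
  simp only [hw]
  ring

lemma signSum_add {n : ℕ} (p q s t : Fin n) :
    signSum p q p t + signSum p q s q = signSum p q s t := by
  simp [signSum, add_comm]

lemma signSum_self {n : ℕ} (i j : Fin n) : signSum i j i j = 0 := by simp [signSum]

/-- The entire function `(exp z - 1) / z`. -/
noncomputable def expSlope : ℂ → ℂ := dslope Complex.exp 0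

lemma contDiff_expSlope : ContDiff ℂ ∞ expSlope := by
  have : Differentiable ℂ expSlope := differentiableOn_univ.1
    ((Complex.differentiableOn_dslope Filter.univ_mem).2 Complex.differentiable_exp.differentiableOn)
  exact this.contDiff

lemma expSlope_zero : expSlope 0 = 1 := by simp [expSlope]

lemma mul_expSlope (z : ℂ) : z * expSlope z = Complex.exp z - 1 := by
  simpa [expSlope] using sub_smul_dslope Complex.exp 0 z

/-- Multiplied by `x`, this is the addition law of the exponential; it is the cocycle identity
behind `poissonFlow_add`. -/
lemma expSlope_add (x τ σ κ : ℂ) : κ * σ * expSlope (κ * σ * x) +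
    κ * τ * expSlope (κ * τ * x) * Complex.exp (κ * σ * x) =
      κ * (τ + σ) * expSlope (κ * (τ + σ) * x) := by
  by_cases hx : x = 0
  · simp [hx, expSlope_zero]; ring
  · apply mul_right_cancel₀ hx
    have h1 := mul_expSlope (κ * σ * x)
    have h2 := mul_expSlope (κ * τ * x)
    have h3 := mul_expSlope (κ * (τ + σ) * x)
    have h4 : Complex.exp (κ * (τ + σ) * x) =
        Complex.exp (κ * τ * x) * Complex.exp (κ * σ * x) := by
      rw [← Complex.exp_add]; ring_nf
    rw [h4] at h3
    linear_combination h1 + h2 * Complex.exp (κ * σ * x) - h3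

/-- The Hamiltonian flow of the coordinate function `a_{p,q}`. -/
noncomputable def poissonFlow {n : ℕ} (w : Modification n) (p q : Fin n) (τ : ℂ)
    (a : MatSpace n) : MatSpace n := fun s t =>
  Complex.exp (twistExponent w p q s t * τ * a p q) *
    (a s t + signSum p q s t * τ * expSlope (signSum p q s t * τ * a p q) * (a p t * a s q))

/-- The Hamiltonian field of the coordinate function `a_{p,q}`. -/
noncomputable def coordField {n : ℕ} (w : Modification n) (p q : Fin n) (a : MatSpace n) :
    MatSpace n := fun s t => poissonBracket w a p q s t

lemma contDiff_apply₂ {n : ℕ} (s t : Fin n) : ContDiff ℂ ∞ fun a : MatSpace n => a s t :=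
  contDiff_apply_apply ℂ ℂ s t

lemma contDiff_poissonFlow {n : ℕ} (w : Modification n) (p q : Fin n) :
    ContDiff ℂ ∞ fun x : ℂ × MatSpace n => poissonFlow w p q x.1 x.2 := by
  refine contDiff_pi.2 fun s => contDiff_pi.2 fun t => ?_
  have hc : ∀ i j, ContDiff ℂ ∞ fun x : ℂ × MatSpace n => x.2 i j := fun i j =>
    (contDiff_apply₂ i j).comp contDiff_snd
  have hl : ∀ c : ℂ, ContDiff ℂ ∞ fun x : ℂ × MatSpace n => c * x.1 * x.2 p q := fun c =>
    (contDiff_const.mul contDiff_fst).mul (hc p q)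
  exact (Complex.contDiff_exp.comp (hl _)).mul ((hc s t).add
    (((contDiff_const.mul contDiff_fst).mul (contDiff_expSlope.comp (hl _))).mul
      ((hc p t).mul (hc s q))))

lemma poissonFlow_zero {n : ℕ} (w : Modification n) (p q : Fin n) (a : MatSpace n) :
    poissonFlow w p q 0 a = a := by
  funext s t
  simp [poissonFlow]

/-- Since `a_{p,q}` does not change, row `p` and column `q` evolve by exponentials, and the other
entries solve linear equations with source a multiple of `a_{p,t} a_{s,q}`. The function `expSlope`
covers `a_{p,q} = 0` as well. -/
lemma poissonFlow_self {n : ℕ} (w : Modification n) (p q : Fin n) (τ : ℂ) (a : MatSpace n) :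
    poissonFlow w p q τ a p q = a p q := by
  simp [poissonFlow, twistExponent_self, signSum_self]

lemma poissonFlow_row {n : ℕ} (w : Modification n) (p q : Fin n) (τ : ℂ) (a : MatSpace n)
    (t : Fin n) : poissonFlow w p q τ a p t =
      Complex.exp ((twistExponent w p q p t + signSum p q p t) * τ * a p q) * a p t := by
  have h := mul_expSlope (signSum p q p t * τ * a p q)
  simp only [poissonFlow]
  rw [add_mul, add_mul, Complex.exp_add]
  linear_combination Complex.exp (twistExponent w p q p t * τ * a p q) * a p t * h

lemma poissonFlow_column {n : ℕ} (w : Modification n) (p q : Fin n) (τ : ℂ) (a : MatSpace n)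
    (s : Fin n) : poissonFlow w p q τ a s q =
      Complex.exp ((twistExponent w p q s q + signSum p q s q) * τ * a p q) * a s q := by
  have h := mul_expSlope (signSum p q s q * τ * a p q)
  simp only [poissonFlow]
  rw [add_mul, add_mul, Complex.exp_add]
  linear_combination Complex.exp (twistExponent w p q s q * τ * a p q) * a s q * h

lemma poissonFlow_add {n : ℕ} (w : Modification n) (p q : Fin n) (τ σ : ℂ) (a : MatSpace n) :
    poissonFlow w p q (τ + σ) a = poissonFlow w p q τ (poissonFlow w p q σ a) := by
  funext s t
  conv_rhs => rw [poissonFlow, poissonFlow_row w p q σ a t, poissonFlow_column w p q σ a s,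
    poissonFlow_self w p q σ a]
  have hx : (Complex.exp ((twistExponent w p q p t + signSum p q p t) * σ * a p q) * a p t) *
      (Complex.exp ((twistExponent w p q s q + signSum p q s q) * σ * a p q) * a s q) =
      Complex.exp (twistExponent w p q s t * σ * a p q) *
        Complex.exp (signSum p q s t * σ * a p q) * (a p t * a s q) := by
    rw [← twistExponent_add w p q s t, ← signSum_add p q s t]
    push_cast
    rw [← Complex.exp_add]
    have : ∀ u v x y z W : ℂ, Complex.exp u * x * (Complex.exp v * y) =
      Complex.exp (u + v) * (x * y) := fun u v x y _ _ => by rw [Complex.exp_add]; ring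
    rw [this _ _ _ _ 0 0]
    ring_nf
  rw [hx]
  have h := expSlope_add (a p q) τ σ (signSum p q s t)
  have he : Complex.exp (twistExponent w p q s t * (τ + σ) * a p q) =
      Complex.exp (twistExponent w p q s t * τ * a p q) *
      Complex.exp (twistExponent w p q s t * σ * a p q) := by
    rw [← Complex.exp_add]; ring_nf
  simp only [poissonFlow]
  rw [he]
  linear_combination -Complex.exp (twistExponent w p q s t * τ * a p q) *
      Complex.exp (twistExponent w p q s t * σ * a p q) * (a p t * a s q) * h

lemma hasDerivAt_poissonFlow {n : ℕ} (w : Modification n) (p q : Fin n) (τ : ℂ)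
    (a : MatSpace n) : HasDerivAt (fun σ => poissonFlow w p q σ a)
      (coordField w p q (poissonFlow w p q τ a)) τ := by
  -- It suffices to differentiate at time zero; the group law transports the result to `τ`.
  have h0 : ∀ b : MatSpace n, HasDerivAt (fun σ => poissonFlow w p q σ b)
      (coordField w p q b) 0 := by
    intro b
    refine hasDerivAt_pi.2 fun s => hasDerivAt_pi.2 fun t => ?_
    have hl : ∀ c : ℂ, HasDerivAt (fun σ : ℂ => c * σ * b p q) (c * b p q) 0 := fun c => by
      simpa using ((hasDerivAt_id (0 : ℂ)).const_mul c).mul_const (b p q)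
    have h1 := (hl (twistExponent w p q s t)).cexp
    have h2 : HasDerivAt (fun σ : ℂ => expSlope (signSum p q s t * σ * b p q))
        (deriv expSlope 0 * (signSum p q s t * b p q)) 0 :=
      HasDerivAt.comp_of_eq (0 : ℂ)
        ((contDiff_expSlope.differentiable (by simp)) 0).hasDerivAt (hl (signSum p q s t))
        (by simp)
    have h3 := (((((hasDerivAt_id (0 : ℂ)).const_mul (signSum p q s t : ℂ)).mul h2).mul_const
      (b p t * b s q)).const_add (b s t))
    refine (h1.mul h3).congr_deriv ?_
    simp [coordField, poissonBracket_eq, expSlope_zero]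
    ring
  have h1 : HasDerivAt (fun σ => poissonFlow w p q σ (poissonFlow w p q τ a))
      (coordField w p q (poissonFlow w p q τ a)) (τ - τ) := by
    rw [sub_self]; exact h0 _
  refine (h1.comp_sub_const τ τ).congr_of_eventuallyEq (Filter.Eventually.of_forall fun s => ?_)
  simp [← poissonFlow_add]

lemma hasFDerivAt_apply₂ {n : ℕ} (s t : Fin n) (a : MatSpace n) :
    HasFDerivAt (fun a : MatSpace n => a s t)
      ((ContinuousLinearMap.proj t).comp (ContinuousLinearMap.proj (R := ℂ)
        (φ := fun _ : Fin n => Fin n → ℂ) s)) a :=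
  ((ContinuousLinearMap.proj t).comp (ContinuousLinearMap.proj (R := ℂ)
        (φ := fun _ : Fin n => Fin n → ℂ) s)).hasFDerivAt

lemma contDiff_coordField {n : ℕ} (w : Modification n) (p q : Fin n) :
    ContDiff ℂ ∞ (coordField w p q) := by
  refine contDiff_pi.2 fun s => contDiff_pi.2 fun t => ?_
  simp only [coordField, poissonBracket_eq]
  exact (contDiff_const.mul ((contDiff_apply₂ p t).mul (contDiff_apply₂ s q))).add
    (contDiff_const.mul ((contDiff_apply₂ s t).mul (contDiff_apply₂ p q)))

lemma fderiv_coordField {n : ℕ} (w : Modification n) (p q : Fin n) (a v : MatSpace n) :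
    fderiv ℂ (coordField w p q) a v = fun s t => bracketDeriv w a p q s t v := by
  have h : HasFDerivAt (coordField w p q) _ a := hasFDerivAt_pi.2 fun s => hasFDerivAt_pi.2 fun t =>
    HasFDerivAt.congr_of_eventuallyEq
      ((((hasFDerivAt_apply₂ p t a).mul (hasFDerivAt_apply₂ s q a)).const_mul
        (signSum p q s t : ℂ)).add (((hasFDerivAt_apply₂ s t a).mul
          (hasFDerivAt_apply₂ p q a)).const_mul (twistExponent w p q s t : ℂ)))
      (Filter.Eventually.of_forall fun b => poissonBracket_eq w b p q s t)
  rw [h.fderiv]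
  funext s t
  simp [bracketDeriv]
  ring

/-- The partial derivatives of `{a_{i,j}, a_{k,l}}`, the structure functions of the commutator of
two coordinate fields. -/
noncomputable def structureFun {n : ℕ} (w : Modification n) (ij kl uv : Fin n × Fin n)
    (a : MatSpace n) : ℂ :=
  signSum ij.1 ij.2 kl.1 kl.2 * ((if uv = (ij.1, kl.2) then a kl.1 ij.2 else 0) +
    (if uv = (kl.1, ij.2) then a ij.1 kl.2 else 0)) +
  twistExponent w ij.1 ij.2 kl.1 kl.2 * ((if uv = kl then a ij.1 ij.2 else 0) +
    (if uv = ij then a kl.1 kl.2 else 0))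

/-- The Jacobi identity in terms of vector fields, in the form of the hypothesis of
`fderiv_flow_mem_span`. -/
lemma commutator_coordField {n : ℕ} (w : Modification n) (ij kl : Fin n × Fin n)
    (a : MatSpace n) :
    fderiv ℂ (coordField w kl.1 kl.2) a (coordField w ij.1 ij.2 a) -
      fderiv ℂ (coordField w ij.1 ij.2) a (coordField w kl.1 kl.2 a) =
    ∑ uv, structureFun w ij kl uv a • coordField w uv.1 uv.2 a := by
  rw [fderiv_coordField, fderiv_coordField]
  funext s t
  have h := bracket_jacobi w a ij.1 ij.2 kl.1 kl.2 s t
  simp only [Pi.sub_apply, Finset.sum_apply, Pi.smul_apply, smul_eq_mul]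
  refine h.trans ?_
  simp only [structureFun, add_mul, mul_add, Finset.sum_add_distrib, mul_assoc, ite_mul, mul_ite,
    zero_mul, mul_zero, Finset.sum_ite_eq', Finset.mem_univ, if_true]
  simp [coordField]

lemma continuous_structureFun {n : ℕ} (w : Modification n) (ij kl uv : Fin n × Fin n) :
    Continuous (structureFun w ij kl uv) := by
  have hite : ∀ (P : Prop) [Decidable P] (i j : Fin n),
      Continuous fun a : MatSpace n => if P then a i j else 0 := by
    intro P _ i j
    split_ifs
    · exact continuous_apply_apply i j
    · exact continuous_const
  exact (continuous_const.mul ((hite _ _ _).add (hite _ _ _))).add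
    (continuous_const.mul ((hite _ _ _).add (hite _ _ _)))

/-- The complex span of the Hamiltonian fields of the coordinate functions. -/
noncomputable def coordSpan {n : ℕ} (w : Modification n) (a : MatSpace n) :
    Submodule ℂ (MatSpace n) :=
  Submodule.span ℂ (range fun pq : Fin n × Fin n => coordField w pq.1 pq.2 a)

lemma hamiltonianField_eq {n : ℕ} (w : Modification n) (f : MatSpace n → ℂ) (a : MatSpace n) :
    hamiltonianField w f a =
      ∑ ij : Fin n × Fin n, fderiv ℂ f a (Pi.single ij.1 (Pi.single ij.2 1)) •
        coordField w ij.1 ij.2 a := by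
  funext s t
  simp [hamiltonianField, Fintype.sum_prod_type, coordField]

lemma hamiltonianDistribution_eq {n : ℕ} (w : Modification n) (a : MatSpace n) :
    hamiltonianDistribution w a = coordSpan w a := by
  ext v
  constructor
  · rintro ⟨f, -, rfl⟩
    rw [hamiltonianField_eq]
    exact Submodule.sum_mem _ fun ij _ =>
      Submodule.smul_mem _ _ (Submodule.subset_span ⟨ij, rfl⟩)
  · intro hv
    obtain ⟨c, rfl⟩ := (Submodule.mem_span_range_iff_exists_fun ℂ).1 hv
    -- A linear function has constant partial derivatives, so the coefficients can be prescribed.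
    let f : MatSpace n →L[ℂ] ℂ := ∑ ij : Fin n × Fin n,
      c ij • ((ContinuousLinearMap.proj ij.2).comp (ContinuousLinearMap.proj (R := ℂ)
        (φ := fun _ : Fin n => Fin n → ℂ) ij.1))
    refine ⟨f, f.contDiff, ?_⟩
    rw [hamiltonianField_eq]
    refine Finset.sum_congr rfl fun ij _ => ?_
    rw [f.fderiv]
    congr 1
    have : ∀ x : Fin n × Fin n, (Pi.single ij.1 (Pi.single ij.2 1) : MatSpace n) x.1 x.2 =
        if x = ij then 1 else 0 := by
      rintro ⟨x, y⟩
      obtain ⟨i, j⟩ := ij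
      by_cases hx : x = i
      · subst hx; simp [Pi.single_apply]
      · simp [hx]
    simp [f, this]

lemma contDiff_real_poissonFlow {n : ℕ} (w : Modification n) (p q : Fin n) (c : ℂ) :
    ContDiff ℝ ∞ fun x : ℝ × MatSpace n => poissonFlow w p q (x.1 * c) x.2 := by
  have h0 : ContDiff ℝ ∞ fun r : ℝ => (r : ℂ) := Complex.ofRealCLM.contDiff
  have h1 : ContDiff ℝ ∞ fun x : ℝ × MatSpace n => (x.1 : ℂ) * c :=
    (h0.comp contDiff_fst).mul contDiff_const
  have h2 : ContDiff ℝ ∞ fun x : ℂ × MatSpace n => poissonFlow w p q x.1 x.2 :=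
    (contDiff_poissonFlow w p q).restrict_scalars ℝ
  exact ContDiff.comp (g := fun x : ℂ × MatSpace n => poissonFlow w p q x.1 x.2)
    (f := fun x : ℝ × MatSpace n => ((x.1 : ℂ) * c, x.2)) h2 (h1.prodMk contDiff_snd)

lemma hasDerivAt_real_poissonFlow {n : ℕ} (w : Modification n) (p q : Fin n) (c : ℂ)
    (a : MatSpace n) : HasDerivAt (fun t : ℝ => poissonFlow w p q (t * c) a)
      (c • coordField w p q a) 0 := by
  have h1 : HasDerivAt (fun r : ℝ => (r : ℂ) * c) c 0 := by
    simpa using (Complex.ofRealCLM.hasDerivAt (x := 0)).mul_const c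
  have h2 := hasDerivAt_poissonFlow w p q 0 a
  rw [poissonFlow_zero] at h2
  exact HasDerivAt.scomp_of_eq (0 : ℝ) h2 h1 (by simp)

/-- The complex span is a real span once every complex multiple of a field counts as a generator;
this is why the flow family carries an index in `ℂ`. -/
lemma coordSpan_restrictScalars {n : ℕ} (w : Modification n) (a : MatSpace n) :
    (coordSpan w a).restrictScalars ℝ = Submodule.span ℝ (range
      fun k : (Fin n × Fin n) × ℂ => k.2 • coordField w k.1.1 k.1.2 a) := by
  apply le_antisymm
  · intro v hv
    obtain ⟨c, rfl⟩ := (Submodule.mem_span_range_iff_exists_fun ℂ).1 hv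
    exact Submodule.sum_mem _ fun ij _ => Submodule.subset_span ⟨(ij, c ij), rfl⟩
  · rw [Submodule.span_le]
    rintro _ ⟨k, rfl⟩
    exact Submodule.smul_mem (coordSpan w a) _ (Submodule.subset_span ⟨k.1, rfl⟩)

lemma fderiv_poissonFlow_mem {n : ℕ} (w : Modification n) (p q : Fin n) (τ : ℂ)
    {a v : MatSpace n} (hv : v ∈ coordSpan w a) :
    fderiv ℝ (poissonFlow w p q τ) a v ∈ coordSpan w (poissonFlow w p q τ a) := by
  have h1 : DifferentiableAt ℂ (poissonFlow w p q τ) a :=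
    ((contDiff_poissonFlow w p q).comp
      (contDiff_const.prodMk contDiff_id)).differentiable (by simp) a
  rw [h1.fderiv_restrictScalars ℝ]
  exact fderiv_flow_mem_span (contDiff_poissonFlow w p q)
    (poissonFlow_zero w _ _) (poissonFlow_add w _ _) (contDiff_coordField w _ _)
    (hasDerivAt_poissonFlow w _ _)
    (fun l : Fin n × Fin n => contDiff_coordField w l.1 l.2)
    (continuous_structureFun w (p, q)) (commutator_coordField w (p, q)) _ _ _ hv

/-- The Hamiltonian flows of the complex multiples of the coordinate functions. -/
noncomputable def poissonFlowFamily {n : ℕ} (w : Modification n) :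
    FlowFamily ((Fin n × Fin n) × ℂ) (MatSpace n) where
  flow k t a := poissonFlow w k.1.1 k.1.2 (t * k.2) a
  smooth k := contDiff_real_poissonFlow w k.1.1 k.1.2 k.2
  flow_zero k a := by simp [poissonFlow_zero]
  flow_add k s t a := by simp [add_mul, poissonFlow_add]
  dist a := (coordSpan w a).restrictScalars ℝ
  dist_eq a := by
    simp only [(hasDerivAt_real_poissonFlow w _ _ _ a).deriv, coordSpan_restrictScalars]
  invariant k t _ _ hv := fderiv_poissonFlow_mem w k.1.1 k.1.2 (t * k.2) hv

theorem isSymplecticLeaf_iff {n : ℕ} (w : Modification n) (L : Set (MatSpace n)) :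
    IsSymplecticLeaf w L ↔ ∃ a, L = (poissonFlowFamily w).orbit a := by
  rw [← FlowFamily.maximal_isIntegralManifold_iff, IsSymplecticLeaf]
  have : hamiltonianDistribution w =
      fun a => ((poissonFlowFamily w).dist a : Set (MatSpace n)) :=
    funext fun a => hamiltonianDistribution_eq w a
  rw [this]

end PoissonFlows

/-! ### The scaling group and the independence of the loaves from `℘`. -/

section Loaves

/-- The factor by which an element of the scaling group multiplies the coordinate `a_{s,t}`. -/
noncomputable def scaleFactor {n : ℕ} (c : SimpleRoot n → ℂˣ) (s t : Fin n) : ℂ :=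
  ((∏ r, c r ^ rootPairing (alphaRoot s t) (Pi.single r 1) : ℂˣ) : ℂ)

lemma scaleBy_apply {n : ℕ} (c : SimpleRoot n → ℂˣ) (a : MatSpace n) (s t : Fin n) :
    scaleBy c a s t = scaleFactor c s t * a s t := rfl

lemma scaleFactor_mul {n : ℕ} (c d : SimpleRoot n → ℂˣ) (s t : Fin n) :
    scaleFactor (c * d) s t = scaleFactor c s t * scaleFactor d s t := by
  simp [scaleFactor, mul_zpow, Finset.prod_mul_distrib]

lemma scaleBy_mul {n : ℕ} (c d : SimpleRoot n → ℂˣ) (a : MatSpace n) :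
    scaleBy (c * d) a = scaleBy c (scaleBy d a) := by
  funext s t
  simp only [scaleBy_apply, scaleFactor_mul, mul_assoc]

lemma scaleBy_one {n : ℕ} (a : MatSpace n) : scaleBy 1 a = a := by
  funext s t
  simp [scaleBy_apply, scaleFactor]

lemma scaleFactor_eq {n : ℕ} (c : SimpleRoot n → ℂˣ) (s t : Fin n) :
    scaleFactor c s t = c (Sum.inl ()) *
      (∏ k : Fin (n - 1), if k.val < s.val then (c (Sum.inr (Sum.inl k)) : ℂ) else 1) *
      ∏ k : Fin (n - 1), if k.val < t.val then (c (Sum.inr (Sum.inr k)) : ℂ) else 1 := by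
  have h : ∀ r, rootPairing (alphaRoot s t) (Pi.single r 1) = alphaRoot s t r := by
    intro r
    simp [rootPairing, Pi.single_apply]
  simp only [scaleFactor, h]
  simp [Fintype.prod_sum_type, alphaRoot, mul_assoc, apply_ite (Units.val : ℂˣ → ℂ)]

/-- The factor is a product of a function of the row and a function of the column, so all terms of
the bracket scale alike. -/
lemma scaleFactor_mul_scaleFactor {n : ℕ} (c : SimpleRoot n → ℂˣ) (p q s t : Fin n) :
    scaleFactor c p t * scaleFactor c s q = scaleFactor c p q * scaleFactor c s t := by
  simp only [scaleFactor_eq]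
  ring

lemma exp_sum_differences {n : ℕ} (x : Fin n → ℂ) (s : Fin n) :
    ∏ k : Fin (n - 1), (if k.val < s.val then
      Complex.exp (x ⟨k.val + 1, by omega⟩ - x ⟨k.val, by omega⟩) else 1) =
    Complex.exp (x s - x ⟨0, s.pos⟩) := by
  have h : ∀ k : Fin (n - 1), (if k.val < s.val then
      Complex.exp (x ⟨k.val + 1, by omega⟩ - x ⟨k.val, by omega⟩) else 1) =
      (fun m => if h : m < s.val then
        Complex.exp (x ⟨m + 1, by omega⟩ - x ⟨m, by omega⟩) else 1) k.val := by
    intro k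
    split_ifs with hk
    · simp [hk]
    · simp [hk]
  rw [Finset.prod_congr rfl fun k _ => h k, Fin.prod_univ_eq_prod_range
    (fun m => if h : m < s.val then
        Complex.exp (x ⟨m + 1, by omega⟩ - x ⟨m, by omega⟩) else 1) (n - 1)]
  -- The product telescopes until `N` reaches `s`, and is constant afterwards.
  have key : ∀ N, ∏ m ∈ Finset.range N, (if h : m < s.val then
        Complex.exp (x ⟨m + 1, by omega⟩ - x ⟨m, by omega⟩) else 1) =
      Complex.exp (x ⟨min N s.val, by omega⟩ - x ⟨0, s.pos⟩) := by
    intro N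
    induction N with
    | zero => simp
    | succ N ih =>
      rw [Finset.prod_range_succ, ih]
      by_cases hN : N < s.val
      · have h1 : min N s.val = N := by omega
        have h2 : min (N + 1) s.val = N + 1 := by omega
        simp only [hN, dite_true, h1, h2, ← Complex.exp_add]
        ring_nf
      · have h1 : min N s.val = s.val := by omega
        have h2 : min (N + 1) s.val = s.val := by omega
        simp only [hN, dite_false, h1, h2, mul_one]
  rw [key]
  have h1 : min (n - 1) s.val = s.val := by omega
  simp only [h1]

/-- The root `β` carries the value at the first row and column; the compact roots carry the
exponentials of successive differences of `x` and of `y`. -/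
lemma exists_scaleFactor_eq {n : ℕ} (x y : Fin n → ℂ) :
    ∃ c : SimpleRoot n → ℂˣ, ∀ s t, scaleFactor c s t = Complex.exp (x s + y t) := by
  rcases Nat.eq_zero_or_pos n with rfl | hn
  · exact ⟨1, fun s => s.elim0⟩
  let e : ℂ → ℂˣ := fun z => Units.mk0 (Complex.exp z) (Complex.exp_ne_zero z)
  refine ⟨Sum.elim (fun _ => e (x ⟨0, hn⟩ + y ⟨0, hn⟩))
    (Sum.elim (fun k => e (x ⟨k.val + 1, by omega⟩ - x ⟨k.val, by omega⟩))
      (fun k => e (y ⟨k.val + 1, by omega⟩ - y ⟨k.val, by omega⟩))), fun s t => ?_⟩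
  rw [scaleFactor_eq]
  simp only [Sum.elim_inl, Sum.elim_inr, e, Units.val_mk0, exp_sum_differences,
    ← Complex.exp_add]
  ring_nf

/-- Scaling multiplies the Hamiltonian `a_{p,q}` by a constant and respects the bracket, so it only
changes the speed of the flow. -/
lemma poissonFlow_scaleBy {n : ℕ} (w : Modification n) (p q : Fin n) (τ : ℂ)
    (c : SimpleRoot n → ℂˣ) (a : MatSpace n) :
    poissonFlow w p q τ (scaleBy c a) =
      scaleBy c (poissonFlow w p q (scaleFactor c p q * τ) a) := by
  funext s t
  have h := scaleFactor_mul_scaleFactor c p q s t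
  have h1 : ∀ z : ℂ, z * τ * (scaleFactor c p q * a p q) =
      z * (scaleFactor c p q * τ) * a p q := fun z => by ring
  simp only [poissonFlow, scaleBy_apply, h1]
  linear_combination Complex.exp (twistExponent w p q s t * (scaleFactor c p q * τ) * a p q) *
    (signSum p q s t * τ * expSlope (signSum p q s t * (scaleFactor c p q * τ) * a p q) *
      (a p t * a s q)) * h

/-- The parameter enters the flow only through the exponential prefactor. The quotient of two
prefactors has an exponent of the form `x_s + y_t`; the scaling depends on the point `a`. -/
lemma exists_poissonFlow_eq_scaleBy {n : ℕ} (w w' : Modification n) (p q : Fin n) (τ : ℂ)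
    (a : MatSpace n) : ∃ c : SimpleRoot n → ℂˣ,
      poissonFlow w p q τ a = scaleBy c (poissonFlow w' p q τ a) := by
  obtain ⟨P, Q, R, U, hw⟩ := exists_twistExponent_eq w
  obtain ⟨P', Q', R', U', hw'⟩ := exists_twistExponent_eq w'
  obtain ⟨c, hc⟩ := exists_scaleFactor_eq
    (fun s => ((P s p + Q s q - P p s - R q s) - (P' s p + Q' s q - P' p s - R' q s)) * τ * a p q)
    (fun t => ((R t p + U t q - Q p t - U q t) - (R' t p + U' t q - Q' p t - U' q t)) * τ * a p q)
  refine ⟨c, ?_⟩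
  funext s t
  rw [scaleBy_apply, hc]
  simp only [poissonFlow]
  conv_rhs => rw [← mul_assoc, ← Complex.exp_add]
  congr 2
  rw [hw, hw']
  push_cast
  ring

lemma exists_mem_orbit_scaleBy {n : ℕ} (w w' : Modification n) {a b : MatSpace n}
    (hb : b ∈ (poissonFlowFamily w).orbit a) :
    ∃ c : SimpleRoot n → ℂˣ, ∃ b' ∈ (poissonFlowFamily w').orbit a, b = scaleBy c b' := by
  induction hb with
  | refl => exact ⟨1, a, FlowFamily.mem_orbit_self _ a, (scaleBy_one a).symm⟩
  | tail _ h ih =>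
    obtain ⟨k, t, rfl⟩ := h
    obtain ⟨c, b', hb', rfl⟩ := ih
    obtain ⟨d, hd⟩ := exists_poissonFlow_eq_scaleBy w w' k.1.1 k.1.2
      (scaleFactor c k.1.1 k.1.2 * (t * k.2)) b'
    -- The rescaled time is complex, so it goes into the index of the flow, with real time `1`.
    refine ⟨c * d, (poissonFlowFamily w').flow (k.1, scaleFactor c k.1.1 k.1.2 * (t * k.2)) 1 b',
      FlowFamily.flow_mem_orbit _ hb' _ _, ?_⟩
    change poissonFlow w k.1.1 k.1.2 (t * k.2) (scaleBy c b') = scaleBy (c * d)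
      (poissonFlow w' k.1.1 k.1.2 ((1 : ℝ) * (scaleFactor c k.1.1 k.1.2 * (t * k.2))) b')
    rw [poissonFlow_scaleBy, hd, scaleBy_mul, Complex.ofReal_one, one_mul]

lemma scaleBy_orbit_subset {n : ℕ} (w w' : Modification n) (a : MatSpace n) :
    {b | ∃ c : SimpleRoot n → ℂˣ, ∃ x ∈ (poissonFlowFamily w).orbit a, b = scaleBy c x} ⊆
      {b | ∃ c : SimpleRoot n → ℂˣ, ∃ x ∈ (poissonFlowFamily w').orbit a, b = scaleBy c x} := by
  rintro _ ⟨c, x, hx, rfl⟩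
  obtain ⟨d, y, hy, rfl⟩ := exists_mem_orbit_scaleBy w w' hx
  exact ⟨c * d, y, hy, (scaleBy_mul c d y).symm⟩

theorem symplecticLoaves_eq {n : ℕ} (w w' : Modification n) :
    symplecticLoaves w = symplecticLoaves w' := by
  have key : ∀ w w' : Modification n, symplecticLoaves w ⊆ symplecticLoaves w' := by
    rintro w w' _ ⟨L, hL, rfl⟩
    obtain ⟨a, rfl⟩ := (isSymplecticLeaf_iff w L).1 hL
    exact ⟨(poissonFlowFamily w').orbit a, (isSymplecticLeaf_iff w' _).2 ⟨a, rfl⟩,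
      (scaleBy_orbit_subset w w' a).antisymm (scaleBy_orbit_subset w' w a)⟩
  exact (key w w').antisymm (key w' w)

end Loaves

/-! ### Congruences at `q = ε` and powers of `q`-commuting elements. -/

section SemiclassicalLimit

open LaurentPolynomial

/-- Congruence modulo `q - ε` in an algebra over the Laurent polynomials in `q`. -/
def EpsCong {A : Type*} [Ring A] [Algebra ℂ[T;T⁻¹] A] (ε : ℂ) (x y : A) : Prop :=
  ∃ V : A, x = y + (T 1 - C ε : ℂ[T;T⁻¹]) • V

namespace EpsCong

variable {A : Type*} [Ring A] [Algebra ℂ[T;T⁻¹] A] {ε : ℂ} {x y z x' y' : A}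

lemma refl (x : A) : EpsCong ε x x := ⟨0, by simp⟩

lemma symm (h : EpsCong ε x y) : EpsCong ε y x := by
  obtain ⟨V, rfl⟩ := h
  exact ⟨-V, by simp⟩

lemma trans (h : EpsCong ε x y) (h' : EpsCong ε y z) : EpsCong ε x z := by
  obtain ⟨V, rfl⟩ := h
  obtain ⟨V', rfl⟩ := h'
  exact ⟨V' + V, by rw [smul_add, add_assoc]⟩

lemma add (h : EpsCong ε x y) (h' : EpsCong ε x' y') : EpsCong ε (x + x') (y + y') := by
  obtain ⟨V, rfl⟩ := h
  obtain ⟨V', rfl⟩ := h'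
  exact ⟨V + V', by rw [smul_add]; abel⟩

lemma smul (f : ℂ[T;T⁻¹]) (h : EpsCong ε x y) : EpsCong ε (f • x) (f • y) := by
  obtain ⟨V, rfl⟩ := h
  exact ⟨f • V, by rw [smul_add, smul_comm]⟩

lemma zsmul (k : ℤ) (h : EpsCong ε x y) : EpsCong ε (k • x) (k • y) := by
  obtain ⟨V, rfl⟩ := h
  exact ⟨k • V, by rw [smul_add, smul_comm]⟩

lemma of_dvd {f g : ℂ[T;T⁻¹]} (h : (T 1 - C ε : ℂ[T;T⁻¹]) ∣ f - g) (x : A) :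
    EpsCong ε (f • x) (g • x) := by
  obtain ⟨u, hu⟩ := h
  refine ⟨u • x, ?_⟩
  rw [smul_smul, ← hu, ← add_smul, add_sub_cancel]

end EpsCong

lemma dvd_T_sub_one {m : ℕ} {ε : ℂ} (hε : ε ^ m = 1) :
    (T 1 - C ε : ℂ[T;T⁻¹]) ∣ T (m : ℤ) - 1 := by
  have h := sub_dvd_pow_sub_pow (T 1 : ℂ[T;T⁻¹]) (C ε) m
  rwa [T_pow, ← map_pow, hε, map_one, mul_one] at h

/-- The quotient of `q ^ (m e) - 1` by `q ^ m - 1` is congruent to `e`. -/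
lemma exists_T_mul_sub_one (m : ℕ) (e : ℤ) : ∃ G H : ℂ[T;T⁻¹],
    T (m * e) - 1 = (T (m : ℤ) - 1) * G ∧ G = ((e : ℤ) : ℂ[T;T⁻¹]) + (T (m : ℤ) - 1) * H := by
  induction e using Int.induction_on with
  | zero => exact ⟨0, 0, by simp, by simp⟩
  | succ i ih =>
    obtain ⟨G, H, h1, h2⟩ := ih
    refine ⟨T m * G + 1, G + H, ?_, ?_⟩
    · rw [mul_add, mul_one, T_add]
      linear_combination (T m : ℂ[T;T⁻¹]) * h1
    · push_cast at h2 ⊢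
      linear_combination h2
  | pred i ih =>
    obtain ⟨G, H, h1, h2⟩ := ih
    have h3 : (T (-m : ℤ) : ℂ[T;T⁻¹]) * T m = 1 := by rw [← T_add]; simp
    refine ⟨T (-m : ℤ) * (G - 1), H - T (-m : ℤ) * (G - 1), ?_, ?_⟩
    · have h4 : (m : ℤ) * (-(i : ℤ) - 1) = m * -(i : ℤ) + -m := by ring
      rw [h4, T_add]
      linear_combination (T (-m : ℤ) : ℂ[T;T⁻¹]) * h1 + h3
    · push_cast at h2 ⊢
      linear_combination h2 + h3 * (G - 1)

lemma dvd_T_mul_sub_one {m : ℕ} {ε : ℂ} (hε : ε ^ m = 1) (e : ℤ) :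
    (T 1 - C ε : ℂ[T;T⁻¹]) ∣ T (m * e) - 1 := by
  obtain ⟨G, -, h, -⟩ := exists_T_mul_sub_one m e
  rw [h]
  exact (dvd_T_sub_one hε).mul_right G

lemma EpsCong.T_smul {A : Type*} [Ring A] [Algebra ℂ[T;T⁻¹] A] {m : ℕ} {ε : ℂ}
    (hε : ε ^ m = 1) {k : ℤ} (hk : (m : ℤ) ∣ k) (x : A) :
    EpsCong ε ((T k : ℂ[T;T⁻¹]) • x) x := by
  obtain ⟨e, rfl⟩ := hk
  have := EpsCong.of_dvd (g := 1) (dvd_T_mul_sub_one hε e) x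
  rwa [one_smul] at this

/-- The multiples of `m (q ^ m - 1)` whose quotient by it is congruent to a given element. -/
def QuotCong {A : Type*} [Ring A] [Algebra ℂ[T;T⁻¹] A] (m : ℕ) (ε : ℂ) (x y : A) : Prop :=
  ∃ W : A, x = ((m : ℂ[T;T⁻¹]) * (T (m : ℤ) - 1)) • W ∧ EpsCong ε W y

namespace QuotCong

variable {A : Type*} [Ring A] [Algebra ℂ[T;T⁻¹] A] {m : ℕ} {ε : ℂ} {x y x' y' : A}

lemma add (h : QuotCong m ε x y) (h' : QuotCong m ε x' y') :
    QuotCong m ε (x + x') (y + y') := by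
  obtain ⟨W, rfl, hW⟩ := h
  obtain ⟨W', rfl, hW'⟩ := h'
  exact ⟨W + W', (smul_add _ _ _).symm, hW.add hW'⟩

lemma smul (f : ℂ[T;T⁻¹]) (h : QuotCong m ε x y) : QuotCong m ε (f • x) (f • y) := by
  obtain ⟨W, rfl, hW⟩ := h
  exact ⟨f • W, smul_comm _ _ _, hW.smul f⟩

lemma neg (h : QuotCong m ε x y) : QuotCong m ε (-x) (-y) := by
  have := h.smul (-1)
  simpa using this

lemma congr (h : QuotCong m ε x y) (h' : EpsCong ε y y') : QuotCong m ε x y' := by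
  obtain ⟨W, rfl, hW⟩ := h
  exact ⟨W, rfl, hW.trans h'⟩

lemma epsCong_zero (hε : ε ^ m = 1) (h : QuotCong m ε x y) : EpsCong ε x 0 := by
  obtain ⟨W, rfl, -⟩ := h
  obtain ⟨u, hu⟩ := dvd_T_sub_one hε
  exact ⟨((m : ℂ[T;T⁻¹]) * u) • W, by rw [hu, zero_add, smul_smul]; ring_nf⟩

/-- Dividing by `q^m - 1` leaves a factor congruent to `m e`, and the normalization removes the `m`.
-/
lemma T_sub_one_smul (hm : m ≠ 0) (hε : ε ^ m = 1) (e : ℤ) (x : A) :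
    QuotCong m ε ((T (m * (m * e)) - 1 : ℂ[T;T⁻¹]) • x) (e • x) := by
  obtain ⟨G, H, h1, h2⟩ := exists_T_mul_sub_one m (m * e)
  obtain ⟨u, hu⟩ := dvd_T_sub_one hε
  have hm' : (m : ℂ[T;T⁻¹]) * C ((m : ℂ)⁻¹) = 1 := by
    rw [← map_natCast (C : ℂ →+* ℂ[T;T⁻¹]), ← map_mul, mul_inv_cancel₀ (by exact_mod_cast hm),
      map_one]
  refine ⟨(C ((m : ℂ)⁻¹) * G) • x, ?_, ?_⟩
  · rw [smul_smul, h1]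
    congr 1
    linear_combination -(T (m : ℤ) - 1) * G * hm'
  · have : EpsCong ε ((C ((m : ℂ)⁻¹) * G) • x) ((e : ℂ[T;T⁻¹]) • x) := by
      refine EpsCong.of_dvd ⟨C ((m : ℂ)⁻¹) * u * H, ?_⟩ x
      rw [h2, hu]
      push_cast
      linear_combination (e : ℂ[T;T⁻¹]) * hm'
    rwa [Int.cast_smul_eq_zsmul] at this

/-- A multiple of `(q - ε) (q ^ m - 1)` has quotient congruent to zero. -/
lemma of_dvd (hm : m ≠ 0) {f : ℂ[T;T⁻¹]} (h : (T 1 - C ε) * (T (m : ℤ) - 1) ∣ f) (x : A) :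
    QuotCong m ε (f • x) 0 := by
  obtain ⟨u, rfl⟩ := h
  have hm' : (m : ℂ[T;T⁻¹]) * C ((m : ℂ)⁻¹) = 1 := by
    rw [← map_natCast (C : ℂ →+* ℂ[T;T⁻¹]), ← map_mul, mul_inv_cancel₀ (by exact_mod_cast hm),
      map_one]
  refine ⟨(T 1 - C ε) • (C ((m : ℂ)⁻¹) * u) • x, ?_, ⟨(C ((m : ℂ)⁻¹) * u) • x, by simp⟩⟩
  rw [smul_smul, smul_smul]
  congr 1
  linear_combination -((T 1 - C ε) * (T (m : ℤ) - 1)) * u * hm'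

end QuotCong

lemma mul_pow_of_qcomm {A : Type*} [Ring A] [Algebra ℂ[T;T⁻¹] A] {x y : A} {e : ℤ}
    (h : x * y = (T e : ℂ[T;T⁻¹]) • (y * x)) (k : ℕ) :
    x * y ^ k = (T (k * e) : ℂ[T;T⁻¹]) • (y ^ k * x) := by
  induction k with
  | zero => simp
  | succ k ih =>
    rw [pow_succ, ← mul_assoc, ih, smul_mul_assoc, mul_assoc, h, mul_smul_comm, smul_smul, ← T_add,
      ← mul_assoc]
    push_cast
    ring_nf

lemma pow_mul_pow_of_qcomm {A : Type*} [Ring A] [Algebra ℂ[T;T⁻¹] A] {x y : A} {e : ℤ}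
    (h : x * y = (T e : ℂ[T;T⁻¹]) • (y * x)) (k l : ℕ) :
    x ^ l * y ^ k = (T (l * (k * e)) : ℂ[T;T⁻¹]) • (y ^ k * x ^ l) := by
  induction l with
  | zero => simp
  | succ l ih =>
    rw [pow_succ, mul_assoc, mul_pow_of_qcomm h, mul_smul_comm, ← mul_assoc, ih, smul_mul_assoc,
      smul_smul, ← T_add, mul_assoc, ← pow_succ]
    push_cast
    ring_nf

lemma QuotCong.of_qcomm {A : Type*} [Ring A] [Algebra ℂ[T;T⁻¹] A] {x y : A} {e : ℤ}
    (h : x * y = (T e : ℂ[T;T⁻¹]) • (y * x)) {m : ℕ} (hm : m ≠ 0) {ε : ℂ} (hε : ε ^ m = 1) :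
    QuotCong m ε (x ^ m * y ^ m - y ^ m * x ^ m) (e • (y ^ m * x ^ m)) := by
  have := QuotCong.T_sub_one_smul hm hε e (y ^ m * x ^ m)
  rwa [sub_smul, one_smul, ← pow_mul_pow_of_qcomm h] at this

lemma choose_two_succ (k : ℕ) : (k + 1).choose 2 = k.choose 2 + k := by
  rw [Nat.choose_succ_succ' k 1, Nat.choose_one_right, add_comm]

lemma choose_two_of_odd (l : ℕ) : (2 * l + 1).choose 2 = (2 * l + 1) * l := by
  rw [Nat.choose_two_right, Nat.add_sub_cancel, mul_left_comm, Nat.mul_div_cancel_left _ two_pos]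

lemma mul_pow_eq_of_qcomm {A : Type*} [Ring A] [Algebra ℂ[T;T⁻¹] A] {x y : A} {e : ℤ}
    (h : x * y = (T e : ℂ[T;T⁻¹]) • (y * x)) (k : ℕ) :
    x ^ k * y ^ k = (T (e * k.choose 2) : ℂ[T;T⁻¹]) • (x * y) ^ k := by
  induction k with
  | zero => simp
  | succ k ih =>
    rw [pow_succ, pow_succ y, mul_assoc, ← mul_assoc x, mul_pow_of_qcomm h, smul_mul_assoc,
      mul_smul_comm, mul_assoc, ← mul_assoc, ih, smul_mul_assoc, smul_smul, ← T_add, ← pow_succ,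
      choose_two_succ]
    push_cast
    ring_nf

/-- Hence the powers of `q` with exponent a multiple of `m.choose 2`, which arise from reordering
`m`-th powers, become `1` at `ε`. -/
lemma dvd_choose_two {m : ℕ} (hm : Odd m) : (m : ℤ) ∣ (m.choose 2 : ℤ) := by
  obtain ⟨l, rfl⟩ := hm
  refine ⟨l, ?_⟩
  exact_mod_cast choose_two_of_odd l

/-- As `2` is invertible modulo `m`, the odd powers of `ζ` are all the `m`-th roots of unity, each
once. -/
lemma prod_add_odd_pow_mul {R : Type*} [CommRing R] [IsDomain R] {ζ : R} {m : ℕ} (hm : Odd m)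
    (hζ : IsPrimitiveRoot ζ m) (x y : R) :
    ∏ i ∈ Finset.range m, (x + ζ ^ (2 * i + 1) * y) = x ^ m + y ^ m := by
  classical
  rw [IsPrimitiveRoot.pow_add_pow_eq_prod_add_mul x y hm hζ]
  have h2 : IsPrimitiveRoot (ζ ^ 2) m := hζ.pow_of_coprime 2 (Nat.coprime_two_left.2 hm)
  have hinj : Set.InjOn (fun i => ζ ^ (2 * i + 1)) (Finset.range m : Set ℕ) := by
    intro i hi j hj hij
    simp only [pow_succ, pow_mul] at hij
    have h0 : ζ ≠ 0 := hζ.ne_zero hm.pos.ne'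
    exact h2.pow_inj (Finset.mem_range.1 hi) (Finset.mem_range.1 hj)
      (by simpa [pow_succ] using mul_right_cancel₀ h0 hij)
  have himg : (Finset.range m).image (fun i => ζ ^ (2 * i + 1)) =
      Polynomial.nthRootsFinset m (1 : R) := by
    refine Finset.eq_of_subset_of_card_le ?_ ?_
    · intro z hz
      obtain ⟨i, -, rfl⟩ := Finset.mem_image.1 hz
      rw [Polynomial.mem_nthRootsFinset hm.pos, ← pow_mul, mul_comm, pow_mul, hζ.pow_eq_one,
        one_pow]
    · rw [Finset.card_image_of_injOn hinj, hζ.card_nthRootsFinset, Finset.card_range]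
  rw [← himg, Finset.prod_image hinj]

end SemiclassicalLimit

/-! ### Products of commuting linear factors. -/

section LinearFactors

open scoped Polynomial

variable {R : Type*} [CommRing R]

/-- The product of the linear factors `x + t_i y` for `i < k`, in the polynomial ring in `x` and
`y`. -/
noncomputable def linearProd (t : ℕ → R) (k : ℕ) : R[X][X] :=
  ∏ i ∈ Finset.range k, (Polynomial.C Polynomial.X + Polynomial.C (Polynomial.C (t i)) * Polynomial.X)

lemma linearProd_dvd {m : ℕ} (hm : Odd m) {ε : ℂ} (hε : IsPrimitiveRoot ε m) (c : ℂ →+* R)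
    (q : R) (t : ℕ → R) (ht : ∀ i, q - c ε ∣ t i - q ^ (2 * i + 1)) :
    Polynomial.C (Polynomial.C (q - c ε)) ∣
      linearProd t m - ((Polynomial.C Polynomial.X) ^ m + Polynomial.X ^ m) := by
  rw [← Ideal.mem_span_singleton, ← Ideal.Quotient.eq]
  set π := Ideal.Quotient.mk (Ideal.span {(Polynomial.C (Polynomial.C (q - c ε)) : R[X][X])})
  have h1 : ∀ x y : R, q - c ε ∣ x - y →
      π (Polynomial.C (Polynomial.C x)) = π (Polynomial.C (Polynomial.C y)) := by
    intro x y hxy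
    rw [Ideal.Quotient.eq, Ideal.mem_span_singleton, ← map_sub, ← map_sub]
    exact map_dvd _ (map_dvd _ hxy)
  have h2 : ∀ i, π (Polynomial.C (Polynomial.C (t i))) =
      π (Polynomial.C (Polynomial.C (c ε))) ^ (2 * i + 1) := by
    intro i
    rw [h1 _ _ (ht i), map_pow, map_pow, map_pow, h1 _ _ (dvd_refl (q - c ε))]
  have h4 := prod_add_odd_pow_mul (R := ℂ[X][X]) hm
    (hε.map_of_injective (f := (Polynomial.C : ℂ[X] →+* ℂ[X][X]).comp Polynomial.C)
      (Polynomial.C_injective.comp Polynomial.C_injective)) (Polynomial.C Polynomial.X)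
      Polynomial.X
  -- The factorization is proved in the domain `ℂ[X][X]` and carried to the quotient, which need not
  -- be a domain.
  let ρ : ℂ[X][X] →+* _ := Polynomial.eval₂RingHom
    (Polynomial.eval₂RingHom (π.comp ((Polynomial.C.comp Polynomial.C).comp c))
      (π (Polynomial.C Polynomial.X))) (π Polynomial.X)
  have h5 := congrArg ρ h4
  simp only [map_prod, map_add, map_mul, map_pow, ρ, RingHom.comp_apply,
    Polynomial.coe_eval₂RingHom, Polynomial.eval₂_C, Polynomial.eval₂_X] at h5
  rw [linearProd, map_prod, map_add, map_pow, map_pow, ← h5]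
  refine Finset.prod_congr rfl fun i _ => ?_
  rw [map_add, map_mul, h2]

/-- The endomorphism multiplying the second variable by a scalar. -/
noncomputable def scaleSecond (f : R) : R[X][X] →+* R[X][X] :=
  Polynomial.eval₂RingHom Polynomial.C (Polynomial.C (Polynomial.C f) * Polynomial.X)

lemma scaleSecond_C (f : R) (p : R[X]) : scaleSecond f (Polynomial.C p) = Polynomial.C p := by
  simp [scaleSecond]

lemma scaleSecond_X (f : R) :
    scaleSecond f Polynomial.X = Polynomial.C (Polynomial.C f) * Polynomial.X := by
  simp [scaleSecond]

/-- Modulo `f - 1` the rescaling fixes the generators, hence everything. -/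
lemma scaleSecond_sub_dvd (f : R) (x : R[X][X]) :
    Polynomial.C (Polynomial.C (f - 1)) ∣ scaleSecond f x - x := by
  rw [← Ideal.mem_span_singleton, ← Ideal.Quotient.eq]
  have h : (Ideal.Quotient.mk (Ideal.span {(Polynomial.C (Polynomial.C (f - 1)) : R[X][X])})).comp
      (scaleSecond f) = Ideal.Quotient.mk _ := by
    refine Polynomial.ringHom_ext (fun a => ?_) ?_
    · rw [RingHom.comp_apply, scaleSecond_C]
    · rw [RingHom.comp_apply, scaleSecond_X, Ideal.Quotient.eq, Ideal.mem_span_singleton]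
      refine ⟨Polynomial.X, ?_⟩
      rw [map_sub, map_sub, map_one, map_one]
      ring
  exact congrArg (fun g => g x) h

lemma scaleSecond_linearProd (f : R) (t : ℕ → R) (k : ℕ) :
    scaleSecond f (linearProd t k) = linearProd (fun i => f * t i) k := by
  simp only [linearProd, map_prod, map_add, map_mul, scaleSecond_C, scaleSecond_X]
  refine Finset.prod_congr rfl fun i _ => ?_
  ring

variable {A : Type*} [Ring A] [Algebra R A]

/-- Evaluation of polynomials in two variables at two commuting elements of an algebra. -/
noncomputable def evalCommuting (x y : A) (h : Commute x y) : R[X][X] →+* A :=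
  Polynomial.eval₂RingHom' (Polynomial.aeval x : R[X] →ₐ[R] A).toRingHom y
    fun p => by
      induction p using Polynomial.induction_on' with
      | add p q hp hq => rw [map_add]; exact hp.add_left hq
      | monomial k a =>
        simp only [AlgHom.toRingHom_eq_coe, RingHom.coe_coe, Polynomial.aeval_monomial]
        exact (Algebra.commute_algebraMap_left a y).mul_left (h.pow_left k)

variable {x y : A} (h : Commute x y)

lemma evalCommuting_C (f : R) : evalCommuting x y h (Polynomial.C (Polynomial.C f)) =
    algebraMap R A f := by
  simp [evalCommuting]

lemma evalCommuting_C_X :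
    evalCommuting x y h (Polynomial.C Polynomial.X : R[X][X]) = x := by
  simp [evalCommuting]

lemma evalCommuting_X : evalCommuting x y h (Polynomial.X : R[X][X]) = y := by
  simp [evalCommuting]

/-- The product of the commuting elements `x + t_i y` for `i < k`. -/
noncomputable def commutingProd (t : ℕ → R) (k : ℕ) : A := evalCommuting x y h (linearProd t k)

lemma commutingProd_zero (t : ℕ → R) : commutingProd h t 0 = 1 := by
  simp [commutingProd, linearProd]

lemma commutingProd_succ (t : ℕ → R) (k : ℕ) :
    commutingProd h t (k + 1) = commutingProd h t k * (x + t k • y) := by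
  simp only [commutingProd, linearProd, Finset.prod_range_succ, map_mul, map_add, evalCommuting_C,
    evalCommuting_C_X, evalCommuting_X, Algebra.smul_def]

lemma commutingProd_succ' (t : ℕ → R) (k : ℕ) :
    commutingProd h t (k + 1) = commutingProd h (fun i => t (i + 1)) k * (x + t 0 • y) := by
  simp only [commutingProd, linearProd, Finset.prod_range_succ', map_mul, map_add, evalCommuting_C,
    evalCommuting_C_X, evalCommuting_X, Algebra.smul_def]

/-- Moving an element past a product of linear factors. -/
lemma mul_commutingProd {a : A} {e s : R}
    (hs : ∀ f : R, a * (x + f • y) = e • ((x + (s * f) • y) * a)) (t : ℕ → R) (k : ℕ) :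
    a * commutingProd h t k = e ^ k • (commutingProd h (fun i => s * t i) k * a) := by
  induction k with
  | zero => simp [commutingProd_zero]
  | succ k ih =>
    rw [commutingProd_succ, commutingProd_succ, ← mul_assoc, ih, smul_mul_assoc, mul_assoc, hs,
      mul_smul_comm, smul_smul, ← pow_succ, ← mul_assoc]

/-- If the scalars `t i` are congruent to the odd powers of a primitive root of unity of odd order,
then the product of the linear factors is congruent to a sum of two powers, and the effect of
rescaling the second element is controlled. -/
lemma exists_commutingProd_eq {m : ℕ} (hm : Odd m) {ε : ℂ} (hε : IsPrimitiveRoot ε m)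
    (c : ℂ →+* R) (q : R) (t : ℕ → R) (ht : ∀ i, q - c ε ∣ t i - q ^ (2 * i + 1)) (f g : R) :
    ∃ r r' : A, commutingProd h t m = x ^ m + y ^ m + (q - c ε) • r ∧
      g • commutingProd h (fun i => f * t i) m - commutingProd h t m =
        (g - 1) • x ^ m + (g * f ^ m - 1) • y ^ m +
          (((q - c ε) * (g - 1)) • r + ((q - c ε) * (f - 1)) • r') := by
  obtain ⟨r, hr⟩ := linearProd_dvd hm hε c q t ht
  obtain ⟨r', hr'⟩ := scaleSecond_sub_dvd f r
  have hP := congrArg (scaleSecond f) hr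
  rw [map_sub, map_add, map_mul, map_pow, map_pow, scaleSecond_linearProd, scaleSecond_X,
    scaleSecond_C, scaleSecond_C, mul_pow, ← map_pow, ← map_pow] at hP
  refine ⟨evalCommuting x y h r, evalCommuting x y h (Polynomial.C (Polynomial.C g) * r'), ?_, ?_⟩
  · have := congrArg (evalCommuting x y h) (sub_eq_iff_eq_add.1 hr)
    rw [commutingProd, this]
    simp only [map_add, map_mul, map_pow, evalCommuting_C, evalCommuting_C_X, evalCommuting_X,
      Algebra.smul_def]
    abel
  -- The remainder `(q - ε) r` becomes `q - ε` times `g r(x, f y) - r = (g - 1) r + g (r(x, f y) -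
  -- r)`, and the last bracket is divisible by `f - 1`.
  · have key : Polynomial.C (Polynomial.C g) * linearProd (fun i => f * t i) m - linearProd t m =
        Polynomial.C (Polynomial.C (g - 1)) * (Polynomial.C Polynomial.X) ^ m +
        Polynomial.C (Polynomial.C (g * f ^ m - 1)) * Polynomial.X ^ m +
        (Polynomial.C (Polynomial.C ((q - c ε) * (g - 1))) * r +
          Polynomial.C (Polynomial.C ((q - c ε) * (f - 1))) *
            (Polynomial.C (Polynomial.C g) * r')) := by
      simp only [map_sub, map_mul, map_one, map_pow] at hP hr hr' ⊢
      linear_combination Polynomial.C (Polynomial.C g) * hP - hr +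
        Polynomial.C (Polynomial.C g) * (Polynomial.C (Polynomial.C q) -
          Polynomial.C (Polynomial.C (c ε))) * hr'
    have := congrArg (evalCommuting x y h) key
    simpa only [commutingProd, map_sub, map_add, map_mul, map_pow, map_one, evalCommuting_C,
      evalCommuting_C_X, evalCommuting_X, Algebra.smul_def] using this

end LinearFactors

/-! ### Quantum determinants and the limit for all pairs of generators. -/

section QuantumMatrices

open LaurentPolynomial

lemma two_mul_choose_two_add {m : ℕ} (hm : Odd m) : 2 * (m.choose 2 : ℤ) + m = m * m := by
  obtain ⟨l, rfl⟩ := hm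
  rw [choose_two_of_odd]
  push_cast
  ring

variable {A : Type*} [Ring A] [Algebra ℂ[T;T⁻¹] A]

/-- The relations between two elements `a`, `d`, their quantum determinant `x` and the rescaled
product `y` of the other two entries of a quantum matrix. -/
structure QuantumDet (h : ℤ) (a d x y : A) : Prop where
  comm : Commute x y
  mul_ad : a * d = x + (T 1 : ℂ[T;T⁻¹]) • y
  mul_da : d * a = (T (-h) : ℂ[T;T⁻¹]) • (x + (T (-1) : ℂ[T;T⁻¹]) • y)
  mul_ax : a * x = (T h : ℂ[T;T⁻¹]) • (x * a)
  mul_dx : d * x = (T (-h) : ℂ[T;T⁻¹]) • (x * d)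
  mul_ay : a * y = (T (h + 2) : ℂ[T;T⁻¹]) • (y * a)
  mul_dy : d * y = (T (-(h + 2)) : ℂ[T;T⁻¹]) • (y * d)

lemma T_smul_T_smul (i j : ℤ) (x : A) :
    (T i : ℂ[T;T⁻¹]) • (T j : ℂ[T;T⁻¹]) • x = (T (i + j) : ℂ[T;T⁻¹]) • x := by
  rw [smul_smul, ← T_add]

lemma qcomm_symm {x y : A} {e : ℤ} (h : x * y = (T e : ℂ[T;T⁻¹]) • (y * x)) :
    y * x = (T (-e) : ℂ[T;T⁻¹]) • (x * y) := by
  rw [h, T_smul_T_smul, neg_add_cancel, T_zero, one_smul]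

/-- Here `z` plays the role of `b c`. Passing `z` through `a` and through `d` gives inverse powers
of `q`, so `z` commutes with `a d` and with the determinant. -/
theorem QuantumDet.of_relation {h r : ℤ} {a d z : A}
    (had : a * d = (T h : ℂ[T;T⁻¹]) • (d * a) +
      ((T 1 - T (-1)) * T r : ℂ[T;T⁻¹]) • z)
    (haz : a * z = (T (h + 2) : ℂ[T;T⁻¹]) • (z * a))
    (hzd : z * d = (T (h + 2) : ℂ[T;T⁻¹]) • (d * z)) :
    QuantumDet h a d (a * d - (T (1 + r) : ℂ[T;T⁻¹]) • z) ((T r : ℂ[T;T⁻¹]) • z) := by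
  have hdz := qcomm_symm hzd
  have hza := qcomm_symm haz
  have hda : d * a = (T (-h) : ℂ[T;T⁻¹]) • (a * d - (T (1 + r) : ℂ[T;T⁻¹]) • z +
      (T (-1 + r) : ℂ[T;T⁻¹]) • z) := by
    have : (T h : ℂ[T;T⁻¹]) • (d * a) = a * d - (T (1 + r) : ℂ[T;T⁻¹]) • z +
      (T (-1 + r) : ℂ[T;T⁻¹]) • z := by
      rw [had, T_add, T_add, sub_mul, sub_smul]
      abel
    rw [← this, T_smul_T_smul, neg_add_cancel, T_zero, one_smul]
  have hcomm : a * d * z = z * (a * d) := by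
    rw [← mul_assoc z, hza, smul_mul_assoc, mul_assoc a z d, hzd, mul_smul_comm, T_smul_T_smul,
      neg_add_cancel, T_zero, one_smul, mul_assoc]
  refine ⟨?_, ?_, ?_, ?_, ?_, ?_, ?_⟩
  · have h1 : Commute (a * d) z := hcomm
    exact ((h1.sub_left ((Commute.refl z).smul_left _))).smul_right _
  · rw [T_smul_T_smul, sub_add_cancel]
  · rw [T_smul_T_smul, ← hda]
  · have h1 : (a * d) * a = a * (d * a) := mul_assoc _ _ _
    have h2 : a * (a * d) = (T h : ℂ[T;T⁻¹]) • ((a * d) * a) +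
        ((T (1 + r + (h + 2)) - T (-1 + r + (h + 2))) : ℂ[T;T⁻¹]) • (z * a) := by
      rw [h1, hda, mul_smul_comm, T_smul_T_smul, add_neg_cancel, T_zero, one_smul, mul_add,
        mul_sub, mul_smul_comm, mul_smul_comm, haz, T_smul_T_smul, T_smul_T_smul, sub_smul]
      abel
    rw [mul_sub, sub_mul, h2, mul_smul_comm, haz, T_smul_T_smul, smul_mul_assoc, smul_sub,
      T_smul_T_smul, sub_smul]
    have : -1 + r + (h + 2) = h + (1 + r) := by ring
    rw [this]
    abel
  · have h1 : d * (a * d) = (d * a) * d := (mul_assoc _ _ _).symm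
    have h2 : d * (a * d) = (T (-h) : ℂ[T;T⁻¹]) • (a * d * d - (T (1 + r) : ℂ[T;T⁻¹]) • (z * d) +
        (T (-1 + r) : ℂ[T;T⁻¹]) • (z * d)) := by
      rw [h1, hda, smul_mul_assoc, add_mul, sub_mul, smul_mul_assoc, smul_mul_assoc]
    rw [mul_sub, h2, mul_smul_comm, hdz, T_smul_T_smul, sub_mul, smul_mul_assoc, smul_add,
      T_smul_T_smul]
    have : -h + (-1 + r) = 1 + r + -(h + 2) := by ring
    rw [this, add_sub_cancel_right]
  · rw [mul_smul_comm, haz, smul_mul_assoc, smul_comm]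
  · rw [mul_smul_comm, hdz, smul_mul_assoc, smul_comm]

namespace QuantumDet

variable {h : ℤ} {a d x y : A} (H : QuantumDet h a d x y)

include H

/-- Passing `a` through a linear factor multiplies the coefficient of `y` by `q²`, hence the step
`2` in the exponents below. -/
lemma mul_factor_left (f : ℂ[T;T⁻¹]) :
    a * (x + f • y) = (T h : ℂ[T;T⁻¹]) • ((x + (T 2 * f) • y) * a) := by
  rw [mul_add, mul_smul_comm, H.mul_ax, H.mul_ay, add_mul, smul_add, smul_mul_assoc, smul_smul,
    smul_smul, T_add]
  congr 2
  ring

lemma mul_factor_right (f : ℂ[T;T⁻¹]) :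
    d * (x + f • y) = (T (-h) : ℂ[T;T⁻¹]) • ((x + (T (-2) * f) • y) * d) := by
  rw [mul_add, mul_smul_comm, H.mul_dx, H.mul_dy, add_mul, smul_add, smul_mul_assoc, smul_smul,
    smul_smul, neg_add, T_add]
  congr 2
  ring

lemma pow_mul_pow_left (k : ℕ) : a ^ k * d ^ k = (T (h * k.choose 2) : ℂ[T;T⁻¹]) •
    commutingProd H.comm (fun i => (T (1 + 2 * i) : ℂ[T;T⁻¹])) k := by
  induction k with
  | zero => simp [commutingProd_zero]
  | succ k ih =>
    rw [pow_succ', pow_succ d, mul_assoc, ← mul_assoc (a ^ k), ih, smul_mul_assoc, mul_smul_comm,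
      ← mul_assoc, mul_commutingProd H.comm H.mul_factor_left, smul_mul_assoc, mul_assoc, H.mul_ad,
      commutingProd_succ', T_pow, T_smul_T_smul, choose_two_succ]
    have e1 : h * (k.choose 2 : ℤ) + k * h = h * ((k.choose 2 + k : ℕ) : ℤ) := by push_cast; ring
    have e2 : (fun i : ℕ => (T 2 * T (1 + 2 * i) : ℂ[T;T⁻¹])) =
        fun i : ℕ => T (1 + 2 * ((i + 1 : ℕ) : ℤ)) := by
      funext i; rw [← T_add]; push_cast; ring_nf
    rw [e1, e2]
    simp

lemma pow_mul_pow_right (k : ℕ) : d ^ k * a ^ k = (T (-(h * (k.choose 2 + k))) : ℂ[T;T⁻¹]) •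
    commutingProd H.comm (fun i => (T (1 - 2 * k + 2 * i) : ℂ[T;T⁻¹])) k := by
  induction k with
  | zero => simp [commutingProd_zero]
  | succ k ih =>
    rw [pow_succ', pow_succ a, mul_assoc, ← mul_assoc (d ^ k), ih, smul_mul_assoc, mul_smul_comm,
      ← mul_assoc, mul_commutingProd H.comm H.mul_factor_right, smul_mul_assoc, mul_assoc, H.mul_da,
      commutingProd_succ, T_pow, mul_smul_comm, T_smul_T_smul, T_smul_T_smul, choose_two_succ]
    have e1 : -(h * ((k.choose 2 : ℤ) + k)) + k * -h + -h =
      -(h * (((k.choose 2 + k : ℕ) : ℤ) + ((k + 1 : ℕ) : ℤ))) := by push_cast; ring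
    have e2 : (fun i : ℕ => (T (-2) * T (1 - 2 * k + 2 * i) : ℂ[T;T⁻¹])) =
        fun i : ℕ => T (1 - 2 * ((k + 1 : ℕ) : ℤ) + 2 * i) := by
      funext i; rw [← T_add]; push_cast; ring_nf
    have e3 : 1 - 2 * ((k + 1 : ℕ) : ℤ) + 2 * k = -1 := by push_cast; ring
    rw [e2, e3, ← e1]

theorem quotCong {m : ℕ} (hm : Odd m) {ε : ℂ} (hε : IsPrimitiveRoot ε m) :
    QuotCong m ε (a ^ m * d ^ m - d ^ m * a ^ m) (h • (d ^ m * a ^ m) + (2 : ℤ) • y ^ m) := by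
  have hm0 := hm.pos.ne'
  have hone := hε.pow_eq_one
  obtain ⟨r, r', h1, h2⟩ := exists_commutingProd_eq H.comm hm hε (C : ℂ →+* ℂ[T;T⁻¹]) (T 1)
    (fun i => T (1 - 2 * m + 2 * i)) (fun i => by
      have e1 : (1 - 2 * m + 2 * i : ℤ) = ((2 * i + 1 : ℕ) : ℤ) * 1 + m * (-2) := by
        push_cast; ring
      rw [T_pow, e1, T_add]
      have := (dvd_T_mul_sub_one hone (-2)).mul_left (T (((2 * i + 1 : ℕ) : ℤ) * 1))
      rw [mul_sub] at this
      simpa only [mul_one] using this) (T (2 * m)) (T (m * (m * h)))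
  have e2 : (fun i : ℕ => (T (2 * m) * T (1 - 2 * m + 2 * i) : ℂ[T;T⁻¹])) =
      fun i : ℕ => T (1 + 2 * i) := by
    funext i; rw [← T_add]; ring_nf
  have e3 : (T (m * (m * h)) * T (2 * m) ^ m : ℂ[T;T⁻¹]) = T (m * (m * (h + 2))) := by
    rw [T_pow, ← T_add]; ring_nf
  rw [e2, e3] at h2
  set c := m.choose 2 with hc
  have hsq : 2 * (c : ℤ) + m = m * m := two_mul_choose_two_add hm
  -- The prefactors `q^(h c)` and `q^(-h (c + m))` have ratio `q^(h m²)`, as `2 c + m = m²`. The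
  -- exponents `1 - 2m, …, -1` become `1, …, 2m - 1` under rescaling `y` by `q^(2m)`.
  have e4 : a ^ m * d ^ m - d ^ m * a ^ m = (T (-(h * (c + m))) : ℂ[T;T⁻¹]) •
      ((T (m * (m * h)) : ℂ[T;T⁻¹]) •
        commutingProd H.comm (fun i => (T (1 + 2 * i) : ℂ[T;T⁻¹])) m -
        commutingProd H.comm (fun i => (T (1 - 2 * m + 2 * i) : ℂ[T;T⁻¹])) m) := by
    rw [H.pow_mul_pow_left, H.pow_mul_pow_right, smul_sub, T_smul_T_smul]
    congr 3
    linear_combination h * hsq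
  have hdvd : (m : ℤ) ∣ -(h * (c + m)) :=
    ((((dvd_choose_two hm).add (dvd_refl _)).mul_left h)).neg_right
  have d1 : (T (m : ℤ) - 1 : ℂ[T;T⁻¹]) ∣ T (m * (m * h)) - 1 := by
    obtain ⟨G, -, h1, -⟩ := exists_T_mul_sub_one m (m * h)
    exact ⟨G, h1⟩
  have d2 : (T (m : ℤ) - 1 : ℂ[T;T⁻¹]) ∣ T (2 * m) - 1 := by
    obtain ⟨G, -, h1, -⟩ := exists_T_mul_sub_one m 2
    rw [mul_comm]
    exact ⟨G, h1⟩
  -- The quotients of the four terms of `h2` are congruent to `h x^m`, `(h + 2) y^m`, `0` and `0`.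
  have hq := ((QuotCong.T_sub_one_smul hm0 hone h (x ^ m)).add
    (QuotCong.T_sub_one_smul hm0 hone (h + 2) (y ^ m))).add
    ((QuotCong.of_dvd hm0 (mul_dvd_mul_left (T 1 - C ε) d1) r).add
      (QuotCong.of_dvd hm0 (mul_dvd_mul_left (T 1 - C ε) d2) r'))
  rw [← h2] at hq
  have hq' := (hq.smul (T (-(h * (c + m))))).congr (EpsCong.T_smul hone hdvd _)
  rw [← e4] at hq'
  refine hq'.congr ?_
  have hda : EpsCong ε (x ^ m + y ^ m) (d ^ m * a ^ m) := by
    have hr : EpsCong ε (commutingProd H.comm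
        (fun i => (T (1 - 2 * m + 2 * i) : ℂ[T;T⁻¹])) m) (x ^ m + y ^ m) := ⟨r, h1⟩
    rw [H.pow_mul_pow_right]
    exact ((EpsCong.T_smul hone hdvd _).trans hr).symm
  have h3 := (hda.zsmul h).add (EpsCong.refl (ε := ε) ((2 : ℤ) • y ^ m))
  convert h3 using 1
  rw [add_smul, smul_add]
  abel

end QuantumDet

/-- The defining relations of the modified quantum matrix algebra, for elements `z i j` of an
arbitrary algebra over the Laurent polynomials. -/
structure IsQuantumMatrix {n : ℕ} (w : Modification n) (z : Fin n → Fin n → A) : Prop where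
  row (i j k : Fin n) (hjk : j < k) : z i j * z i k =
    (T (twistExponent w i j i k + 1) : ℂ[T;T⁻¹]) • (z i k * z i j)
  column (i j k : Fin n) (hik : i < k) : z i j * z k j =
    (T (twistExponent w i j k j + 1) : ℂ[T;T⁻¹]) • (z k j * z i j)
  antidiagonal (i j s t : Fin n) (his : i < s) (htj : t < j) : z i j * z s t =
    (T (twistExponent w i j s t) : ℂ[T;T⁻¹]) • (z s t * z i j)
  diagonal (i j s t : Fin n) (his : i < s) (hjt : j < t) : z i j * z s t =
    (T (twistExponent w i j s t) : ℂ[T;T⁻¹]) • (z s t * z i j) +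
      ((T 1 - T (-1)) * T (rootPairing (alphaRoot s t) (w.zeta i + w.xi j) -
        rootPairing (alphaRoot s j) (w.zeta i + w.xi t)) : ℂ[T;T⁻¹]) • (z i t * z s j)

namespace IsQuantumMatrix

variable {n : ℕ} {w : Modification n} {z : Fin n → Fin n → A} {m : ℕ} {ε : ℂ}

/-- The four entries form a quantum `2 × 2` matrix. The `m`-th power of the rescaled product of the
antidiagonal entries agrees at `ε` with the product of their `m`-th powers, since `m` is odd. -/
lemma quotCong_diagonal (Z : IsQuantumMatrix w z) (hm : Odd m) (hε : IsPrimitiveRoot ε m) (i j s t : Fin n) (his : i < s)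
    (hjt : j < t) : QuotCong m ε (z i j ^ m * z s t ^ m - z s t ^ m * z i j ^ m)
      (twistExponent w i j s t • (z s t ^ m * z i j ^ m) +
        (2 : ℤ) • (z i t ^ m * z s j ^ m)) := by
  have hone := hε.pow_eq_one
  have hab := Z.row i j t hjt
  have hac := Z.column i j s his
  have hbd := Z.column i t s his
  have hcd := Z.row s j t hjt
  have hbc := Z.antidiagonal i t s j his hjt
  have h1 : twistExponent w i j i t + 1 + (twistExponent w i j s j + 1) =
      twistExponent w i j s t + 2 := by
    rw [← twistExponent_add w i j s t]; ring
  have h2 : twistExponent w s j s t + 1 + (twistExponent w i t s t + 1) =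
      twistExponent w i j s t + 2 := by
    obtain ⟨p, q, r, u, hw⟩ := exists_twistExponent_eq w
    simp only [hw]
    ring
  have haz : z i j * (z i t * z s j) = (T (twistExponent w i j s t + 2) : ℂ[T;T⁻¹]) •
      ((z i t * z s j) * z i j) := by
    rw [← mul_assoc, hab, smul_mul_assoc, mul_assoc, hac, mul_smul_comm, T_smul_T_smul, h1,
      mul_assoc]
  have hzd : (z i t * z s j) * z s t = (T (twistExponent w i j s t + 2) : ℂ[T;T⁻¹]) •
      (z s t * (z i t * z s j)) := by
    rw [mul_assoc, hcd, mul_smul_comm, ← mul_assoc, hbd, smul_mul_assoc, T_smul_T_smul, h2,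
      mul_assoc]
  have H := QuantumDet.of_relation (Z.diagonal i j s t his hjt) haz hzd
  refine (H.quotCong hm hε).congr ((EpsCong.refl _).add (EpsCong.zsmul 2 ?_))
  rw [smul_pow, T_pow, mul_pow_eq_of_qcomm hbc]
  refine (EpsCong.T_smul hone ⟨_, rfl⟩ _).trans ?_
  exact (EpsCong.T_smul hone ((dvd_choose_two hm).mul_left _) _).symm

/-- The semiclassical limit for one pair of generators. -/
def Limit (w : Modification n) (z : Fin n → Fin n → A) (m : ℕ) (ε : ℂ) (i j s t : Fin n) : Prop :=
  QuotCong m ε (z i j ^ m * z s t ^ m - z s t ^ m * z i j ^ m)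
    (bracketExpr w (fun k l => z k l ^ m) i j s t)

lemma Limit.epsCong (hε : ε ^ m = 1) {i j s t : Fin n} (h : Limit w z m ε i j s t) :
    EpsCong ε (z i j ^ m * z s t ^ m) (z s t ^ m * z i j ^ m) := by
  have := (h.epsCong_zero hε).add (EpsCong.refl (ε := ε) (z s t ^ m * z i j ^ m))
  rwa [sub_add_cancel, zero_add] at this

lemma limit_self (w : Modification n) (z : Fin n → Fin n → A) (i j : Fin n) : Limit w z m ε i j i j := by
  refine ⟨0, by simp, ?_⟩
  simpa [bracketExpr, twistExponent_self] using EpsCong.refl 0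

lemma sign_of_lt {i j : Fin n} (h : i < j) : Int.sign ((j.val : ℤ) - i.val) = 1 :=
  Int.sign_eq_one_of_pos (by have := Fin.lt_def.1 h; omega)

lemma sign_of_gt {i j : Fin n} (h : j < i) : Int.sign ((j.val : ℤ) - i.val) = -1 :=
  Int.sign_eq_neg_one_of_neg (by have := Fin.lt_def.1 h; omega)

lemma limit_row (Z : IsQuantumMatrix w z) (hm : m ≠ 0) (hε : ε ^ m = 1) (i j k : Fin n) (hjk : j < k) :
    Limit w z m ε i j i k := by
  refine (QuotCong.of_qcomm (Z.row i j k hjk) hm hε).congr ?_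
  simp only [bracketExpr, sign_of_lt hjk, sub_self, Int.sign_zero, zero_add, one_smul, add_smul]
  rw [add_comm]
  exact EpsCong.refl _

lemma limit_column (Z : IsQuantumMatrix w z) (hm : m ≠ 0) (hε : ε ^ m = 1) (i j k : Fin n) (hik : i < k) :
    Limit w z m ε i j k j := by
  have h := QuotCong.of_qcomm (Z.column i j k hik) hm hε
  -- In a column the two products in the bracket have opposite order, so the `m`-th powers must
  -- commute modulo `q - ε`.
  have h0 := (h.epsCong_zero hε).add (EpsCong.refl (ε := ε) (z k j ^ m * z i j ^ m))
  rw [sub_add_cancel, zero_add] at h0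
  refine h.congr ?_
  simp only [bracketExpr, sign_of_lt hik, sub_self, Int.sign_zero, add_zero, one_smul, add_smul]
  rw [add_comm]
  exact h0.symm.add (EpsCong.refl _)

lemma limit_of_lt (Z : IsQuantumMatrix w z) (hm : Odd m) (hε : IsPrimitiveRoot ε m) (i j s t : Fin n) (his : i < s) :
    Limit w z m ε i j s t := by
  rcases lt_trichotomy j t with h | rfl | h
  · refine (Z.quotCong_diagonal hm hε i j s t his h).congr ?_
    simp only [bracketExpr, sign_of_lt his, sign_of_lt h]
    rw [add_comm]
    exact EpsCong.refl _
  · exact Z.limit_column hm.pos.ne' hε.pow_eq_one i j s his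
  · refine (QuotCong.of_qcomm (Z.antidiagonal i j s t his h) hm.pos.ne' hε.pow_eq_one).congr ?_
    simp only [bracketExpr, sign_of_lt his, sign_of_gt h]
    simpa using EpsCong.refl _

/-- The bracket expression is antisymmetric only once the `m`-th powers in it commute modulo `q -
ε`. -/
lemma Limit.swap {i j s t : Fin n} (h : Limit w z m ε i j s t)
    (h1 : EpsCong ε (z i t ^ m * z s j ^ m) (z s j ^ m * z i t ^ m))
    (h2 : EpsCong ε (z i j ^ m * z s t ^ m) (z s t ^ m * z i j ^ m)) :
    Limit w z m ε s t i j := by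
  have h3 := h.neg
  rw [neg_sub] at h3
  refine h3.congr ?_
  have hs : ∀ x y : Fin n, Int.sign ((x.val : ℤ) - y.val) = -Int.sign ((y.val : ℤ) - x.val) :=
    fun x y => by rw [← Int.sign_neg, neg_sub]
  simp only [bracketExpr]
  rw [hs i s, hs j t, twistExponent_swap w i j s t, ← neg_add, neg_add (_ • _), ← neg_smul,
    ← neg_smul]
  exact (h1.zsmul _).add (h2.symm.zsmul _)

theorem limit (Z : IsQuantumMatrix w z) (hm : Odd m) (hε : IsPrimitiveRoot ε m) (i j s t : Fin n) :
    Limit w z m ε i j s t := by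
  have hone := hε.pow_eq_one
  have hm0 := hm.pos.ne'
  rcases lt_trichotomy i s with h | rfl | h
  · exact Z.limit_of_lt hm hε i j s t h
  · rcases lt_trichotomy j t with h | rfl | h
    · exact Z.limit_row hm0 hone i j t h
    · exact limit_self w z i j
    · have hl := Z.limit_row hm0 hone i t j h
      exact hl.swap (hl.epsCong hone).symm (hl.epsCong hone)
  · have hl := Z.limit_of_lt hm hε s t i j h
    exact hl.swap ((Z.limit_of_lt hm hε s j i t h).epsCong hone) (hl.epsCong hone)

end IsQuantumMatrix

theorem ModifiedAlgebra.isQuantumMatrix_gen {n : ℕ} (w : Modification n) :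
    IsQuantumMatrix w (ModifiedAlgebra.gen w) where
  row i j k h := by
    have := RingQuot.mkAlgHom_rel ℂ[T;T⁻¹] (ModifiedRel.row (w := w) i j k h)
    simp only [map_mul, map_smul] at this
    exact this
  column i j k h := by
    have := RingQuot.mkAlgHom_rel ℂ[T;T⁻¹] (ModifiedRel.column (w := w) i j k h)
    simp only [map_mul, map_smul] at this
    exact this
  antidiagonal i j s t h h' := by
    have := RingQuot.mkAlgHom_rel ℂ[T;T⁻¹] (ModifiedRel.antidiagonal (w := w) i j s t h h')
    simp only [map_mul, map_smul] at this
    exact this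
  diagonal i j s t h h' := by
    have := RingQuot.mkAlgHom_rel ℂ[T;T⁻¹] (ModifiedRel.diagonal (w := w) i j s t h h')
    simp only [map_add, map_mul, map_smul] at this
    exact this

end QuantumMatrices

theorem mainTheorem10 (n : ℕ) (hn : 1 ≤ n) :
    (∀ (w : Modification n) (m : ℕ) (ε : ℂ), Odd m → IsPrimitiveRoot ε m →
      IsSemiclassicalLimit w m ε) ∧
    ∀ w w' : Modification n, symplecticLoaves w = symplecticLoaves w' := by
  refine ⟨fun w m ε hm hε i j s t => ?_, symplecticLoaves_eq⟩
  obtain ⟨W, hW, V, hV⟩ := (ModifiedAlgebra.isQuantumMatrix_gen w).limit hm hε i j s t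
  exact ⟨W, V, hW, hV⟩
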